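/- **Model.** The network is a finite connected simple graph with $n$ nodes; at each node $v$ of degree $d$ the incident edges carry distinct port numbers $0,\dots,d-1$ (independently at the two ends of an edge). Two agents with different positive integer labels start at different nodes and move in synchronous rounds. An adversary wakes each agent in a round of its choice; before that the agent is dormant at its starting node, and it may be met there. In each round an awake agent stays idle or tries to leave its node by a chosen port; it knows its label, the rounds since its wake-up, the degree of the current node, the port by which it entered this node ($0$ if it has not moved yet), and whether its attempts succeeded. In a round in which an agent tries to move, the adversary may delay it (it then stays at its node and knows it), but no agent is delayed in more than $c$ consecutive rounds; the integer $c\ge 1$ is unknown to the agents. Rendezvous occurs at the first time when both agents are at the same node (crossing inside an edge does not count). The cost is the total number of edge traversals made by both agents until rendezvous. **Exploration sequences.** A sequence $(x_0,\dots,x_{u-1})$ of natural numbers directs a walk: an agent that entered a node of degree $d$ by port $p$ leaves it, in its $k$-th step ($k=0,\dots,u-1$), by port $(p+x_k)\bmod d$. The sequence is a *UXS for size $n$* if in every connected port-numbered graph with at most $n$ nodes, from every starting node and every entry port there, this walk traverses all edges. Let $(U_u)_{u\ge 0}$ be a family of sequences, $U_u$ of length $u$, and $P:\mathbb N\to\mathbb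 N$ such that $U_u$ is a UXS for size $n$ whenever $u\ge P(n)$. **Algorithm Graph-RV-BF** (for label $\lambda$). Let $q=\lceil\log_2(\lambda+1)\rceil$, $u_q=1$, $c_q=2^q$. Phase $i=0,1,2,\dots$ consists of the stages $0,\dots,2^i-1$, each of $2^{i+4}$ rounds. The agent is idle in all stages except stage $\lambda$ of phases $i\ge q$. That stage consists of three consecutive explorations of $u_ic_i=2^i$ rounds each, followed by $13\cdot 2^i$ idle rounds. An exploration consists of $u_i$ steps of $c_i$ rounds. In step $k$ the agent tries in each round to leave its node by port $(p+x_k)\bmod d$, where $x_k$ is the $k$-th term of $U_{u_i}$, $d$ the degree of the node and $p$ its port of entry, until it succeeds, and it then waits until the end of the step. If it has not moved during a whole step, the exploration fails and the agent is idle until the end of the $u_ic_i$ rounds of this exploration (the remaining explorations are still attempted). If all three explorations succeed, then $u_{i+1}=2u_i$ and $c_{i+1}=c_i$; otherwise $u_{i+1}=u_i$ and $c_{i+1}=2c_i$. The agents stop at rendezvous. **Theorem.** (1) There are families $(U_u)$ as above for which $P$ is a polynomial. (2) There is a constant $C$ such that, for every $(U_u)$ and $P$ as above, in every connected port-numbered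 graph with $n$ nodes, for all different starting nodes, all different positive labels, all wake-up rounds, every $c\ge1$ and every behaviour of the adversary that delays neither agent in more than $c$ consecutive rounds, Algorithm Graph-RV-BF achieves rendezvous at cost at most $$C\,\bigl(\log_2 P(n)+\log_2 c+\log_2 L\bigr)\,P(n),$$ where $L$ is the larger label. In particular, with $P$ a polynomial the cost is polynomial in $n$ and logarithmic in $c$ and $L$. -/

import Mathlib

/-! ### Port-numbered graphs -/

/-- A port numbering of a graph: the edges incident to `v` are numbered `0, …, deg v - 1`,
independently at each node. The bijections `port v` force `deg v` to be the degree of `v`. -/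
structure PortNumbering {V : Type*} (G : SimpleGraph V) where
  deg : V → ℕ
  port : ∀ v : V, Fin (deg v) ≃ G.neighborSet v

namespace PortNumbering

variable {V : Type*} {G : SimpleGraph V}

/-- The location of an agent is a pair (current node, port by which this node was entered).
Leaving the current node by port `x` leads to the neighbour at that port, which is entered by the
port of the same edge at the other endpoint. (If there is no port `x`, nothing happens.) -/
def cross (N : PortNumbering G) (s : V × ℕ) (x : ℕ) : V × ℕ :=
  if h : x < N.deg s.1 then
    let w : G.neighborSet s.1 := N.port s.1 ⟨x, h⟩
    (w.1, ((N.port w.1).symm ⟨s.1, G.adj_symm w.2⟩ : ℕ))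
  else s

/-- The location after the first `k` steps of the walk directed by the sequence `S` from the
location `s`: an agent that entered a node of degree `d` by port `p` exits it by port
`(p + x) mod d`, where `x` is the next term of `S`. -/
def walk (N : PortNumbering G) (S : List ℕ) (s : V × ℕ) (k : ℕ) : V × ℕ :=
  (S.take k).foldl (fun r x => N.cross r ((r.2 + x) % N.deg r.1)) s

/-- The walk directed by `S` from the location `s` traverses all edges of the graph. -/
def TraversesAll (N : PortNumbering G) (S : List ℕ) (s : V × ℕ) : Prop :=
  ∀ e ∈ G.edgeSet, ∃ k < S.length, s((N.walk S s k).1, (N.walk S s (k + 1)).1) = e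

end PortNumbering

/-! ### Universal exploration sequences -/

/-- `S` is a universal exploration sequence for size `n`: in every connected port-numbered graph
with at most `n` nodes, from every node and every entry port, it traverses all edges. -/
def IsUXS (n : ℕ) (S : List ℕ) : Prop :=
  ∀ m ≤ n, ∀ G : SimpleGraph (Fin m), G.Connected → ∀ N : PortNumbering G,
    ∀ v : Fin m, ∀ p < N.deg v, N.TraversesAll S (v, p)

/-- `U u` is the "UXS of length `u`", for every `u`, and length `P n` suffices for size `n`. -/
structure IsUXSFamily (U : ℕ → List ℕ) (P : ℕ → ℕ) : Prop where
  length_eq : ∀ u, (U u).length = u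
  isUXS : ∀ n u, P n ≤ u → IsUXS n (U u)

/-! ### Algorithm Graph-RV-BF -/

namespace GraphRVBF

/-- The variables of the algorithm: `phase` is `i`, `stage` is the index `j` of the current stage
of the phase, `tick` is the number of rounds of this stage that have elapsed, `u` and `c` are the
current estimates, `success` is the success flag of the three explorations, `broken` says that
the current exploration has already failed, `moved` says that the agent has already moved in the
current step of the exploration. -/
structure Memory where
  phase : ℕ
  stage : ℕ
  tick : ℕ
  u : ℕ
  c : ℕ
  success : Bool
  broken : Bool
  moved : Bool

/-- The memory at wake-up of the agent with label `ℓ`: here `q = ⌈log₂ (ℓ + 1)⌉`. -/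
def Memory.initial (ℓ : ℕ) : Memory where
  phase := 0
  stage := 0
  tick := 0
  u := 1
  c := 2 ^ Nat.clog 2 (ℓ + 1)
  success := true
  broken := false
  moved := false

/-- The agent is in the busy part of stage number `ℓ` of a phase. It consists of three
explorations of `c * u` rounds each, every exploration consisting of `u` steps of `c` rounds. -/
def Memory.Busy (ℓ : ℕ) (m : Memory) : Prop :=
  m.stage = ℓ ∧ m.tick < 3 * (m.c * m.u)

instance (ℓ : ℕ) (m : Memory) : Decidable (m.Busy ℓ) :=
  inferInstanceAs (Decidable (_ ∧ _))

/-- The index of the current step within the current exploration. -/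
def Memory.stepIndex (m : Memory) : ℕ := (m.tick % (m.c * m.u)) / m.c

/-- The number of rounds of the current stage. -/
def Memory.stageLength (ℓ : ℕ) (m : Memory) : ℕ :=
  if m.stage = ℓ then 3 * (m.c * m.u) + 13 * 2 ^ m.phase else 2 ^ (m.phase + 4)

/-- The decision of an agent with label `ℓ` located at a node of degree `d` that it entered by
port `p`: `none` means staying idle in this round, `some x` means trying to move by port `x`. -/
def action (U : ℕ → List ℕ) (ℓ : ℕ) (m : Memory) (p d : ℕ) : Option ℕ :=
  if m.Busy ℓ ∧ m.broken = false ∧ m.moved = false then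
    some ((p + (U m.u).getD m.stepIndex 0) % d)
  else none

/-- The update of the flags in one round, where `arrived` tells whether the agent has traversed
an edge in this round. If at the end of a step the agent has not moved during this step, then the
current exploration fails and the agent waits until its end. -/
def Memory.updateFlags (ℓ : ℕ) (m : Memory) (arrived : Bool) : Memory :=
  let moved' := m.moved || arrived
  if m.Busy ℓ ∧ (m.tick + 1) % m.c = 0 then
    { m with
      success := m.success && moved'
      broken := if (m.tick + 1) % (m.c * m.u) = 0 then false else m.broken || !moved'
      moved := false }
  else { m with moved := moved' }

/-- The update of the counters at the end of a round, and of the estimates `u` and `c` at the end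
of stage number `ℓ` of a phase. Phase `i` consists of the stages `0, …, 2 ^ i - 1`. -/
def Memory.advance (ℓ : ℕ) (m : Memory) : Memory :=
  if m.tick + 1 < m.stageLength ℓ then { m with tick := m.tick + 1 }
  else
    { phase := if m.stage + 1 < 2 ^ m.phase then m.phase else m.phase + 1
      stage := if m.stage + 1 < 2 ^ m.phase then m.stage + 1 else 0
      tick := 0
      u := if m.stage = ℓ ∧ m.success = true then 2 * m.u else m.u
      c := if m.stage = ℓ ∧ m.success = false then 2 * m.c else m.c
      success := true
      broken := false
      moved := false }

/-- The update of the memory in one round. -/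
def Memory.update (ℓ : ℕ) (m : Memory) (arrived : Bool) : Memory :=
  (m.updateFlags ℓ arrived).advance ℓ

/-! ### Executions with delay faults -/

variable {V : Type*} {G : SimpleGraph V}

/-- The state of an agent in the graph: its memory, its location (current node, port of entry),
and the number of edge traversals that it has made. -/
structure AgentState (V : Type*) where
  mem : Memory
  loc : V × ℕ
  moves : ℕ

/-- The state at the starting node `v`; the port of entry is `0` by convention. -/
def AgentState.initial (ℓ : ℕ) (v : V) : AgentState V where
  mem := Memory.initial ℓ
  loc := (v, 0)
  moves := 0

/-- What the agent decides to do in its current state. -/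
def AgentState.decision (N : PortNumbering G) (U : ℕ → List ℕ) (ℓ : ℕ) (s : AgentState V) :
    Option ℕ :=
  action U ℓ s.mem s.loc.2 (N.deg s.loc.1)

/-- One round. If the agent decides to move and the adversary imposes a fault (`fault = true`),
then the agent stays at its current node, and is aware of it. -/
def AgentState.round (N : PortNumbering G) (U : ℕ → List ℕ) (ℓ : ℕ) (s : AgentState V)
    (fault : Bool) : AgentState V :=
  match s.decision N U ℓ, fault with
  | some x, false => ⟨s.mem.update ℓ true, N.cross s.loc x, s.moves + 1⟩
  | _, _ => ⟨s.mem.update ℓ false, s.loc, s.moves⟩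

/-- The state at the beginning of round `t` (`t = 0, 1, …`) of the agent with label `ℓ` that starts
at node `v` and is woken up in round `wake`, before which it stays dormant at `v`. The adversary
wants to impose faults exactly in the rounds `t` with `F t = true`. An agent behaves in this way
until rendezvous. -/
def run (N : PortNumbering G) (U : ℕ → List ℕ) (ℓ : ℕ) (v : V) (wake : ℕ) (F : ℕ → Bool) :
    ℕ → AgentState V
  | 0 => AgentState.initial ℓ v
  | t + 1 =>
    if t < wake then run N U ℓ v wake F t
    else (run N U ℓ v wake F t).round N U ℓ (F t)

/-- The agent incurs a fault in round `t`: it is awake, it decides to move, and it is delayed. -/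
def Delayed (N : PortNumbering G) (U : ℕ → List ℕ) (ℓ : ℕ) (v : V) (wake : ℕ) (F : ℕ → Bool)
    (t : ℕ) : Prop :=
  wake ≤ t ∧ ((run N U ℓ v wake F t).decision N U ℓ).isSome = true ∧ F t = true

/-- The agent is never delayed in more than `c` consecutive rounds. -/
def FaultBounded (N : PortNumbering G) (U : ℕ → List ℕ) (ℓ : ℕ) (v : V) (wake : ℕ)
    (F : ℕ → Bool) (c : ℕ) : Prop :=
  ∀ t, ∃ k ≤ c, ¬ Delayed N U ℓ v wake F (t + k)

end GraphRVBF

/-!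
Short universal exploration sequences are obtained by derandomising the simple random walk.
A uniform offset `x < m!` makes the walk step to a uniform neighbour. The expected time `H` until
the walk traverses a given edge from `a` to `b` is at most `n ^ 3`: by conservation of flow
(`sum_killTime_mul_le`) the time from `b`, and the time from any node to a neighbour, is at most
`n ^ 2`, and the times add up along a path. A step that does not traverse the edge lowers `H` by `1`
on average (`exists_edge_potential`), so `H` serves as a potential: summed over all tasks (graph,
port numbering, start, edge) not yet fulfilled, it shrinks by the factor `1 - n ^ (-3)` for a
suitable choice of the next term (`exists_list_potential_le`). As there are only
`2 ^ poly(m)` tasks for `m` nodes, polynomially many terms fulfil all of them.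

For rendezvous, write `x = 2 ^ i` for the length of an exploration in phase `i`. The active part of
phase `i` begins `16 / 3 * (x ^ 2 - 1) + 16 * ℓ * x` rounds after the wake-up. A phase can fail only
if its estimate `c` is at most the true bound, so before rendezvous there are about `log c` failures
at most, and it remains to bound the number of successes after `u` has reached `P = P(n)`. In such a
phase each of the three explorations visits all nodes, hence without rendezvous the other agent
moves during each of them (`Schedule.exists_move`).

* Two such phases (with `u ≥ 8 P`) are never disturbed in the same phase `j` of the other agent
  (`Schedule.not_same_phase`). Otherwise `y = 2 ^ j` exceeds `x ^ 2`, while the three disturbing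
  moves lie in different steps of phase `j`, so that its step length is at most `3 x`; this makes
  the other agent's `u` at least `2 P`. Then that agent has itself been disturbed in an earlier
  phase, of order `y ^ 2` rounds ago, longer than the first agent has been awake.
* Therefore the pairs (phase, disturbing phase) increase in both components, and there are at most
  three of them (`not_four_overlaps`). After the first pair, the phase `i` of the agent that was
  woken up earlier and the phase `j` of the other agent satisfy `j = i` or `j = i - 1`. The first
  case happens at most once because the labels differ, so that the active stages move apart; the
  second one at most once because the quadratic terms differ.

Hence `u < 128 P` until rendezvous (`Schedule.u_lt`), the number of phases that begin before
rendezvous is bounded by `log P + log c` up to a constant, and each of them costs at most `3 u`.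
-/

/-! ### Hitting times of the simple random walk -/

namespace GraphRVBF

section HittingTime

variable {V : Type*} [Fintype V] (G : SimpleGraph V)

open Classical in
/-- The number of neighbours of `v`, as a real number. -/
noncomputable def realDegree (v : V) : ℝ := ∑ w, if G.Adj v w then 1 else 0

open Classical in
/-- The sum of `f` over the neighbours `w` of `v` for which the step `v → w` is not killed. -/
noncomputable def survivorSum (K : V → V → Prop) (f : V → ℝ) (v : V) : ℝ :=
  ∑ w, if G.Adj v w ∧ ¬ K v w then f w else 0

/-- The expected number of steps, counted up to `T`, that the simple random walk started at `v`
makes until its first step `x → y` with `K x y` (which is counted). -/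
noncomputable def killTime (K : V → V → Prop) : ℕ → V → ℝ
  | 0, _ => 0
  | T + 1, v => 1 + (realDegree G v)⁻¹ * survivorSum G K (killTime K T) v

variable {G}

theorem realDegree_nonneg (v : V) : 0 ≤ realDegree G v :=
  Finset.sum_nonneg fun _ _ => by split_ifs <;> norm_num

theorem realDegree_pos {v w : V} (h : G.Adj v w) : 0 < realDegree G v := by
  refine Finset.sum_pos' (fun _ _ => by split_ifs <;> norm_num) ⟨w, Finset.mem_univ _, ?_⟩
  simp [h]

theorem realDegree_le (v : V) : realDegree G v ≤ Fintype.card V := by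
  unfold realDegree
  calc _ ≤ ∑ _w : V, (1 : ℝ) := Finset.sum_le_sum fun _ _ => by split_ifs <;> norm_num
    _ = _ := by simp

theorem survivorSum_mono {K : V → V → Prop} {f g : V → ℝ} (h : ∀ v, f v ≤ g v) (v : V) :
    survivorSum G K f v ≤ survivorSum G K g v :=
  Finset.sum_le_sum fun w _ => by split_ifs <;> simp [h]

theorem survivorSum_nonneg {K : V → V → Prop} {f : V → ℝ} (h : ∀ v, 0 ≤ f v) (v : V) :
    0 ≤ survivorSum G K f v :=
  Finset.sum_nonneg fun w _ => by split_ifs <;> simp [h]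

theorem killTime_nonneg (K : V → V → Prop) (T : ℕ) (v : V) : 0 ≤ killTime G K T v := by
  induction T generalizing v with
  | zero => simp [killTime]
  | succ T ih =>
    have := mul_nonneg (inv_nonneg.2 (realDegree_nonneg (G := G) v)) (survivorSum_nonneg (G := G) (K := K) ih v)
    simp only [killTime]; linarith

theorem killTime_le_succ (K : V → V → Prop) (T : ℕ) (v : V) :
    killTime G K T v ≤ killTime G K (T + 1) v := by
  induction T generalizing v with
  | zero => rw [killTime]; exact killTime_nonneg _ _ _
  | succ T ih =>
    rw [killTime, killTime]
    have := mul_le_mul_of_nonneg_left (survivorSum_mono (G := G) (K := K) ih v)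
      (inv_nonneg.2 (realDegree_nonneg (G := G) v))
    linarith

theorem degree_mul_killTime_succ (K : V → V → Prop) (T : ℕ) {v : V} (hv : 0 < realDegree G v) :
    realDegree G v * killTime G K (T + 1) v
      = realDegree G v + survivorSum G K (killTime G K T) v := by
  rw [killTime]; field_simp

open Classical in
/-- Conservation of flow: the stationary measure of the walk is proportional to the degree, so the
mass killed at each time sums up to at most the total mass `∑ deg`. -/
theorem sum_killTime_mul_le (hdeg : ∀ v, 0 < realDegree G v) (K : V → V → Prop) (T : ℕ) :
    ∑ w, killTime G K T w * (∑ v, if G.Adj v w ∧ K v w then (1 : ℝ) else 0)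
      ≤ (Fintype.card V : ℝ) ^ 2 := by
  have h1 : ∑ v, realDegree G v * killTime G K (T + 1) v
      = ∑ v, realDegree G v + ∑ v, survivorSum G K (killTime G K T) v := by
    rw [← Finset.sum_add_distrib]
    exact Finset.sum_congr rfl fun v _ => degree_mul_killTime_succ K T (hdeg v)
  have h2 : ∑ v, survivorSum G K (killTime G K T) v
      = ∑ w, realDegree G w * killTime G K T w
        - ∑ w, killTime G K T w * (∑ v, if G.Adj v w ∧ K v w then (1 : ℝ) else 0) := by
    unfold survivorSum
    rw [Finset.sum_comm, ← Finset.sum_sub_distrib]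
    refine Finset.sum_congr rfl fun w _ => ?_
    rw [realDegree, Finset.sum_mul, Finset.mul_sum, ← Finset.sum_sub_distrib]
    refine Finset.sum_congr rfl fun v _ => ?_
    rw [G.adj_comm w v]
    by_cases hA : G.Adj v w <;> by_cases hK : K v w <;> simp [hA, hK]
  have h3 : ∑ w, realDegree G w * killTime G K T w ≤ ∑ w, realDegree G w * killTime G K (T + 1) w :=
    Finset.sum_le_sum fun w _ => mul_le_mul_of_nonneg_left (killTime_le_succ K T w)
      (realDegree_nonneg w)
  have h4 : ∑ v, realDegree G v ≤ (Fintype.card V : ℝ) ^ 2 := by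
    calc _ ≤ ∑ _v : V, (Fintype.card V : ℝ) := Finset.sum_le_sum fun v _ => realDegree_le v
      _ = _ := by simp [sq]
  linarith

/-- From a neighbour of `z`, the node `z` is reached in expected time at most `n ^ 2`. -/
theorem killTime_neighbor_le (hdeg : ∀ v, 0 < realDegree G v) {z w : V} (h : G.Adj z w) (T : ℕ) :
    killTime G (fun _ y => y = z) T w ≤ (Fintype.card V : ℝ) ^ 2 := by
  classical
  set K : V → V → Prop := fun _ y => y = z
  have h1 := sum_killTime_mul_le hdeg K (T + 1)
  have h2 : killTime G K (T + 1) z * realDegree G z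
      ≤ ∑ w, killTime G K (T + 1) w * (∑ v, if G.Adj v w ∧ K v w then (1 : ℝ) else 0) := by
    refine le_trans (le_of_eq ?_) (Finset.single_le_sum (fun w _ => ?_) (Finset.mem_univ z))
    · congr 1
      exact Finset.sum_congr rfl fun v _ => by simp [K, G.adj_comm]
    · exact mul_nonneg (killTime_nonneg _ _ _)
        (Finset.sum_nonneg fun _ _ => by split_ifs <;> norm_num)
  have h3 := degree_mul_killTime_succ K T (hdeg z)
  have h4 : killTime G K T w ≤ survivorSum G K (killTime G K T) z := by
    unfold survivorSum
    refine le_trans (le_of_eq ?_) (Finset.single_le_sum (fun w _ => ?_) (Finset.mem_univ w))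
    · simp [h, K, h.ne']
    · split_ifs
      · exact killTime_nonneg _ _ _
      · exact le_rfl
  have h5 := hdeg z
  linarith

/-- The expected time to a killed step is at most the time to reach `z` plus the time from `z`. -/
theorem killTime_le_add (hdeg : ∀ v, 0 < realDegree G v) (K : V → V → Prop) (z w : V) (T : ℕ) :
    killTime G K T w ≤ killTime G (fun _ y => y = z) T w + killTime G K T z := by
  induction T generalizing w with
  | zero => simp [killTime]
  | succ T ih =>
    refine le_trans ?_ (add_le_add_right (killTime_le_succ K T z) _)
    refine le_of_mul_le_mul_left ?_ (hdeg w)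
    rw [mul_add, degree_mul_killTime_succ _ _ (hdeg w), degree_mul_killTime_succ _ _ (hdeg w),
      add_assoc]
    refine add_le_add_right ?_ _
    unfold survivorSum
    rw [realDegree, Finset.sum_mul, ← Finset.sum_add_distrib]
    refine Finset.sum_le_sum fun x _ => ?_
    have h0 := killTime_nonneg (G := G) K T z
    have h1 := killTime_nonneg (G := G) (fun _ y => y = z) T x
    have h2 := ih x
    by_cases hA : G.Adj w x <;> by_cases hK : K w x <;> by_cases hx : x = z
    all_goals simp only [hA, hK, hx, and_true, and_false, not_true_eq_false,
      not_false_eq_true, if_true, if_false]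
    all_goals first | (subst hx; simp only [hA, hK, if_true, if_false, not_true_eq_false,
      not_false_eq_true, and_true, and_false]; linarith) | linarith

/-- Expected times to reach the next node of a path to `b` add up to the expected time to traverse
a given edge from `a` to `b`. -/
theorem killTime_edge_le (hdeg : ∀ v, 0 < realDegree G v) (hG : G.Connected) {a b : V}
    (hab : G.Adj a b) (T : ℕ) (v : V) :
    killTime G (fun x y => x = a ∧ y = b) T v ≤ (Fintype.card V : ℝ) ^ 3 := by
  classical
  set K : V → V → Prop := fun x y => x = a ∧ y = b
  have hb : killTime G K T b ≤ (Fintype.card V : ℝ) ^ 2 := by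
    refine le_trans (le_trans (le_of_eq ?_)
      (Finset.single_le_sum (fun w _ => ?_) (Finset.mem_univ b))) (sum_killTime_mul_le hdeg K T)
    · rw [Finset.sum_eq_single a] <;> simp +contextual [K, hab]
    · exact mul_nonneg (killTime_nonneg _ _ _)
        (Finset.sum_nonneg fun _ _ => by split_ifs <;> norm_num)
  have key : ∀ (x : V) (p : G.Walk x b),
      killTime G K T x ≤ (p.length + 1 : ℝ) * (Fintype.card V : ℝ) ^ 2 := by
    intro x p
    induction p with
    | nil => simpa using hb
    | @cons x y b h p ih =>
      have h1 := killTime_le_add hdeg K y x T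
      have h2 := killTime_neighbor_le hdeg h.symm T
      have h3 := ih hab hb
      rw [SimpleGraph.Walk.length_cons]
      push_cast
      linarith
  obtain ⟨p, hp⟩ := hG.exists_isPath v b
  refine (key v p).trans ?_
  have : (p.length + 1 : ℝ) ≤ Fintype.card V := by exact_mod_cast hp.length_lt
  calc _ ≤ (Fintype.card V : ℝ) * (Fintype.card V : ℝ) ^ 2 := by gcongr
    _ = _ := by ring

/-- The expected time `H` to traverse the edge `ab` from `a` to `b` is a potential: it lies between
`1` and `n ^ 3`, and a random step that does not traverse the edge lowers it by `1` on average. -/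
theorem exists_edge_potential (hG : G.Connected) {a b : V} (hab : G.Adj a b) :
    ∃ H : V → ℝ, (∀ v, 1 ≤ H v) ∧ (∀ v, H v ≤ (Fintype.card V : ℝ) ^ 3) ∧
      ∀ v, survivorSum G (fun x y => x = a ∧ y = b) H v ≤ realDegree G v * (H v - 1) := by
  classical
  have hdeg : ∀ v, 0 < realDegree G v := by
    intro v
    have : Nontrivial V := ⟨a, b, hab.ne⟩
    obtain ⟨w, hw⟩ := hG.preconnected.exists_adj_of_nontrivial v
    exact realDegree_pos hw
  set K : V → V → Prop := fun x y => x = a ∧ y = b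
  have hbdd : ∀ v, BddAbove (Set.range fun T => killTime G K T v) := fun v =>
    ⟨_, by rintro _ ⟨T, rfl⟩; exact killTime_edge_le hdeg hG hab T v⟩
  have hmono : ∀ v, Monotone fun T => killTime G K T v := fun v =>
    monotone_nat_of_le_succ fun T => killTime_le_succ K T v
  have hlim : ∀ v, Filter.Tendsto (fun T => killTime G K T v) Filter.atTop
      (nhds (⨆ T, killTime G K T v)) := fun v => tendsto_atTop_ciSup (hmono v) (hbdd v)
  refine ⟨fun v => ⨆ T, killTime G K T v, fun v => ?_, fun v => ?_, fun v => ?_⟩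
  · refine le_trans ?_ (le_ciSup (hbdd v) 1)
    simp [killTime, survivorSum]
  · exact ciSup_le fun T => killTime_edge_le hdeg hG hab T v
  · have h1 : Filter.Tendsto (fun T => realDegree G v + survivorSum G K (killTime G K T) v)
        Filter.atTop (nhds (realDegree G v + survivorSum G K (fun v => ⨆ T, killTime G K T v) v)) := by
      refine Filter.Tendsto.const_add _ ?_
      unfold survivorSum
      refine tendsto_finsetSum _ fun w _ => ?_
      split_ifs
      · exact hlim w
      · exact tendsto_const_nhds
    have h2 : Filter.Tendsto (fun T => realDegree G v * killTime G K (T + 1) v)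
        Filter.atTop (nhds (realDegree G v * ⨆ T, killTime G K T v)) :=
      ((hlim v).comp (Filter.tendsto_add_atTop_nat 1)).const_mul _
    have h3 := tendsto_nhds_unique h1
      (h2.congr fun T => degree_mul_killTime_succ K T (hdeg v))
    linarith

end HittingTime

end GraphRVBF

/-! ### Walks directed by exploration sequences -/

namespace PortNumbering

variable {V : Type*} {G : SimpleGraph V} (N : PortNumbering G)

theorem cross_of_lt (s : V × ℕ) {x : ℕ} (h : x < N.deg s.1) :
    N.cross s x = ((N.port s.1 ⟨x, h⟩).1, ((N.port (N.port s.1 ⟨x, h⟩).1).symm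
      ⟨s.1, G.adj_symm (N.port s.1 ⟨x, h⟩).2⟩ : ℕ)) := by
  simp [cross, h]

theorem cross_snd_lt (s : V × ℕ) {x : ℕ} (h : x < N.deg s.1) :
    (N.cross s x).2 < N.deg (N.cross s x).1 := by
  rw [cross_of_lt N s h]; exact Fin.is_lt _

theorem deg_pos_of_adj {v w : V} (h : G.Adj v w) : 0 < N.deg v :=
  ((N.port v).symm ⟨w, h⟩).pos

theorem walk_zero (S : List ℕ) (s : V × ℕ) : N.walk S s 0 = s := by simp [walk]

theorem walk_succ (S : List ℕ) (s : V × ℕ) {k : ℕ} (hk : k < S.length) :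
    N.walk S s (k + 1) = N.cross (N.walk S s k)
      (((N.walk S s k).2 + S.getD k 0) % N.deg (N.walk S s k).1) := by
  rw [walk, List.take_add_one, List.foldl_append, List.getElem?_eq_getElem hk,
    List.getD_eq_getElem?_getD, List.getElem?_eq_getElem hk]
  rfl

theorem walk_append_left (S S' : List ℕ) (s : V × ℕ) {k : ℕ} (hk : k ≤ S.length) :
    N.walk (S ++ S') s k = N.walk S s k := by
  simp [walk, List.take_append_of_le_length hk]

theorem walk_append_right (S S' : List ℕ) (s : V × ℕ) (k : ℕ) :
    N.walk (S ++ S') s (S.length + k) = N.walk S' (N.walk S s S.length) k := by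
  rw [walk, List.take_append, List.take_of_length_le (Nat.le_add_right _ _),
    Nat.add_sub_cancel_left, List.foldl_append, walk, walk, List.take_length]

theorem walk_snd_lt (S : List ℕ) (s : V × ℕ) (hs : s.2 < N.deg s.1) {k : ℕ} (hk : k ≤ S.length) :
    (N.walk S s k).2 < N.deg (N.walk S s k).1 := by
  induction k with
  | zero => simpa [walk_zero] using hs
  | succ k ih =>
    have := ih (by omega)
    rw [walk_succ N S s (by omega)]
    exact N.cross_snd_lt _ (Nat.mod_lt _ (by omega))

theorem TraversesAll.append_left {S : List ℕ} {s : V × ℕ} (h : N.TraversesAll S s) (S' : List ℕ) :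
    N.TraversesAll (S ++ S') s := by
  intro e he
  obtain ⟨k, hk, h⟩ := h e he
  refine ⟨k, by simp; omega, ?_⟩
  rw [walk_append_left _ _ _ _ hk.le, walk_append_left _ _ _ _ hk, h]

theorem TraversesAll.append_right {S S' : List ℕ} {s : V × ℕ}
    (h : N.TraversesAll S' (N.walk S s S.length)) : N.TraversesAll (S ++ S') s := by
  intro e he
  obtain ⟨k, hk, h⟩ := h e he
  refine ⟨S.length + k, by simp; omega, ?_⟩
  rw [add_assoc, walk_append_right, walk_append_right, h]

/-- Summing over the ports of a node is summing over its neighbours. -/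
theorem sum_cross [Fintype V] (K : V → V → Prop) (f : V → ℝ) (s : V × ℕ) [DecidableRel K] :
    ∑ x ∈ Finset.range (N.deg s.1), (if K s.1 (N.cross s x).1 then 0 else f (N.cross s x).1)
      = GraphRVBF.survivorSum G K f s.1 := by
  classical
  rw [Finset.sum_range]
  have h1 : ∀ x : Fin (N.deg s.1), (N.cross s x).1 = (N.port s.1 x).1 := fun x => by
    rw [cross_of_lt N s x.2]
  simp only [h1]
  rw [Equiv.sum_comp (N.port s.1) (fun w => if K s.1 w.1 then 0 else f w.1)]
  unfold GraphRVBF.survivorSum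
  rw [← Finset.sum_subtype (Finset.univ.filter fun w => G.Adj s.1 w)
    (p := fun w => w ∈ G.neighborSet s.1) (by simp) (fun w => if K s.1 w then 0 else f w),
    Finset.sum_filter]
  refine Finset.sum_congr rfl fun w _ => ?_
  by_cases hA : G.Adj s.1 w <;> by_cases hK : K s.1 w <;> simp [hA, hK]

theorem cast_deg [Fintype V] (v : V) : (N.deg v : ℝ) = GraphRVBF.realDegree G v := by
  have := N.sum_cross (fun _ _ => False) (fun _ => 1) (v, 0)
  simp only [if_false, Finset.sum_const, Finset.card_range, nsmul_eq_mul, mul_one] at this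
  refine this.trans (Finset.sum_congr rfl fun w _ => ?_)
  by_cases h : G.Adj v w <;> simp [h]

theorem deg_le_card [Fintype V] (v : V) : N.deg v ≤ Fintype.card V := by
  have := GraphRVBF.realDegree_le (G := G) v
  rw [← N.cast_deg] at this
  exact_mod_cast this

end PortNumbering

/-! ### Existence of universal exploration sequences of polynomial length -/

namespace GraphRVBF

/-- A uniform offset modulo a multiple of `d` gives a uniform port, whatever the port of entry. -/
theorem sum_range_mod_of_dvd {d M : ℕ} (h : d ∣ M) (p : ℕ) (f : ℕ → ℝ) :
    (d : ℝ) * ∑ x ∈ Finset.range M, f ((p + x) % d) = M * ∑ y ∈ Finset.range d, f y := by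
  have period : ∀ p, ∑ x ∈ Finset.range d, f ((p + x) % d) = ∑ y ∈ Finset.range d, f y := by
    intro p
    have h1 := Finset.sum_Ico_eq_sum_range (fun y => f (y % d)) p (p + d)
    rw [Nat.add_sub_cancel_left] at h1
    rw [← h1, ← Nat.image_Ico_mod p d, Finset.sum_image]
    exact fun x hx y hy hxy => Nat.mod_injOn_Ico p d (by simpa using hx) (by simpa using hy) hxy
  obtain ⟨k, rfl⟩ := h
  have : ∑ x ∈ Finset.range (d * k), f ((p + x) % d) = k * ∑ y ∈ Finset.range d, f y := by
    induction k with
    | zero => simp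
    | succ k ih =>
      rw [mul_add, mul_one, Finset.sum_range_add, ih]
      simp only [← add_assoc]
      rw [period]
      push_cast; ring
  rw [this]; push_cast; ring

/-- The requirement that a sequence, directing a walk in a given port-numbered graph from the
location `start`, makes this walk traverse a given edge from `a` to `b`. -/
structure EdgeTask (V : Type*) where
  graph : SimpleGraph V
  ports : PortNumbering graph
  start : V × ℕ
  a : V
  b : V
  connected : graph.Connected
  adj : graph.Adj a b
  start_lt : start.2 < ports.deg start.1

/-- The walk directed by `S` fulfils the task. -/
def EdgeTask.Done {V : Type*} (τ : EdgeTask V) (S : List ℕ) : Prop :=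
  ∃ k < S.length, (τ.ports.walk S τ.start k).1 = τ.a ∧ (τ.ports.walk S τ.start (k + 1)).1 = τ.b

theorem EdgeTask.done_concat {V : Type*} (τ : EdgeTask V) (S : List ℕ) (x : ℕ) :
    τ.Done (S ++ [x]) ↔ τ.Done S ∨ ((τ.ports.walk S τ.start S.length).1 = τ.a ∧
      (τ.ports.walk (S ++ [x]) τ.start (S.length + 1)).1 = τ.b) := by
  constructor
  · rintro ⟨k, hk, h1, h2⟩
    rw [List.length_append, List.length_singleton] at hk
    obtain hk | rfl : k < S.length ∨ k = S.length := by omega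
    · rw [PortNumbering.walk_append_left _ _ _ _ hk.le] at h1
      rw [PortNumbering.walk_append_left _ _ _ _ hk] at h2
      exact Or.inl ⟨k, hk, h1, h2⟩
    · rw [PortNumbering.walk_append_left _ _ _ _ le_rfl] at h1
      exact Or.inr ⟨h1, h2⟩
  · rintro (⟨k, hk, h1, h2⟩ | ⟨h1, h2⟩)
    · refine ⟨k, by simp; omega, ?_⟩
      rw [PortNumbering.walk_append_left _ _ _ _ hk.le, PortNumbering.walk_append_left _ _ _ _ hk]
      exact ⟨h1, h2⟩
    · refine ⟨S.length, by simp, ?_, h2⟩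
      rwa [PortNumbering.walk_append_left _ _ _ _ le_rfl]

open Classical in
/-- Derandomisation of the random walk: the sum of the potentials of the unfulfilled tasks shrinks
by the factor `1 - n ^ (-3)` on average over the next term of the sequence, hence for some choice
of this term. -/
theorem exists_list_potential_le {V I : Type*} [Fintype V] [Fintype I] (task : I → EdgeTask V)
    (H : I → V → ℝ) (hle : ∀ i v, H i v ≤ (Fintype.card V : ℝ) ^ 3)
    (hstep : ∀ i v, survivorSum (task i).graph (fun x y => x = (task i).a ∧ y = (task i).b) (H i) v
      ≤ realDegree (task i).graph v * (H i v - 1)) (L : ℕ) :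
    ∃ S : List ℕ, S.length = L ∧
      ∑ i, (if (task i).Done S then 0
        else H i ((task i).ports.walk S (task i).start S.length).1)
      ≤ (1 - 1 / (Fintype.card V : ℝ) ^ 3) ^ L *
        (Fintype.card I * (Fintype.card V : ℝ) ^ 3) := by
  rcases isEmpty_or_nonempty V with hV | ⟨⟨v₀⟩⟩
  · have : IsEmpty I := ⟨fun i => hV.elim (task i).a⟩
    exact ⟨List.replicate L 0, by simp, by simp⟩
  have hK : (1 : ℝ) ≤ (Fintype.card V : ℝ) ^ 3 := by
    have : 1 ≤ Fintype.card V := Fintype.card_pos_iff.2 ⟨v₀⟩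
    exact one_le_pow₀ (by exact_mod_cast this)
  set K : ℝ := (Fintype.card V : ℝ) ^ 3
  have hKinv : 1 / K ≤ 1 := by rw [div_le_one (by linarith)]; exact hK
  induction L with
  | zero =>
    refine ⟨[], rfl, ?_⟩
    calc _ ≤ ∑ _i : I, K := Finset.sum_le_sum fun i _ => by
          split_ifs
          · linarith
          · exact hle _ _
      _ = _ := by simp
  | succ L ih =>
    obtain ⟨S, hS, hΦ⟩ := ih
    set Φ : List ℕ → ℝ := fun S => ∑ i, (if (task i).Done S then 0
        else H i ((task i).ports.walk S (task i).start S.length).1) with hΦdef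
    set M : ℕ := (Fintype.card V).factorial with hM
    have hMpos : 0 < M := Nat.factorial_pos _
    have key : ∑ x ∈ Finset.range M, Φ (S ++ [x]) ≤ ∑ _x ∈ Finset.range M, (1 - 1 / K) * Φ S := by
      rw [Finset.sum_comm, Finset.sum_const, Finset.card_range, nsmul_eq_mul, Finset.mul_sum,
        Finset.mul_sum]
      refine Finset.sum_le_sum fun i _ => ?_
      by_cases hd : (task i).Done S
      · simp [hd, EdgeTask.done_concat]
      · simp only [hd, if_false, EdgeTask.done_concat, false_or]
        set N := (task i).ports
        set r := N.walk S (task i).start S.length with hr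
        have hlt : r.2 < N.deg r.1 := N.walk_snd_lt _ _ (task i).start_lt le_rfl
        have hw : ∀ x, N.walk (S ++ [x]) (task i).start (S.length + 1)
            = N.cross r ((r.2 + x) % N.deg r.1) := fun x => by
          rw [PortNumbering.walk_succ _ _ _ (by simp), N.walk_append_left _ _ _ le_rfl, ← hr]
          simp
        simp only [List.length_append, List.length_singleton, hw]
        have hpos : 0 < N.deg r.1 := by omega
        have hsum := sum_range_mod_of_dvd (M := M)
          (Nat.dvd_factorial hpos (N.deg_le_card _)) r.2
          (fun y => if r.1 = (task i).a ∧ (N.cross r y).1 = (task i).b then 0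
            else H i (N.cross r y).1)
        rw [N.sum_cross (fun x y => x = (task i).a ∧ y = (task i).b) (H i) r] at hsum
        have hposR : (0 : ℝ) < N.deg r.1 := by exact_mod_cast hpos
        refine le_of_mul_le_mul_left (hsum.le.trans ?_) hposR
        have h2 := hstep i r.1
        rw [← N.cast_deg] at h2
        have h3 : H i r.1 - 1 ≤ (1 - 1 / K) * H i r.1 := by
          have : 1 / K * H i r.1 ≤ 1 := by
            rw [one_div, inv_mul_le_iff₀ (by linarith)]
            simpa using hle i r.1
          linarith
        calc (M : ℝ) * _ ≤ M * (N.deg r.1 * ((1 - 1 / K) * H i r.1)) := by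
              gcongr
              exact h2.trans (by gcongr)
          _ = _ := by ring
    obtain ⟨x, -, hx⟩ := Finset.exists_le_of_sum_le
      (Finset.nonempty_range_iff.2 hMpos.ne') key
    refine ⟨S ++ [x], by simp [hS], hx.trans ?_⟩
    rw [pow_succ', mul_assoc]
    exact mul_le_mul_of_nonneg_left hΦ (by linarith)

theorem exists_list_all_done {V I : Type*} [Fintype V] [Fintype I] (task : I → EdgeTask V) (E : ℕ)
    (hE : 0 < E) (hcard : Fintype.card I * Fintype.card V ^ 3 ≤ 2 ^ E) :
    ∃ S : List ℕ, S.length = Fintype.card V ^ 3 * E ∧ ∀ i, (task i).Done S := by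
  classical
  have h := fun i => exists_edge_potential (task i).connected (task i).adj
  choose H h1 h2 h3 using h
  obtain ⟨S, hS, hΦ⟩ := exists_list_potential_le task H h2 h3 (Fintype.card V ^ 3 * E)
  refine ⟨S, hS, fun i => ?_⟩
  by_contra hi
  have hterm : (1 : ℝ) ≤ ∑ i, (if (task i).Done S then 0
        else H i ((task i).ports.walk S (task i).start S.length).1) := by
    refine le_trans ?_ (Finset.single_le_sum (fun j _ => ?_) (Finset.mem_univ i))
    · simp only [hi, if_false]; exact h1 _ _
    · split_ifs
      · exact le_rfl
      · exact zero_le_one.trans (h1 _ _)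
  have hVpos : 0 < Fintype.card V := Fintype.card_pos_iff.2 ⟨(task i).a⟩
  have hK : (0 : ℝ) < (Fintype.card V : ℝ) ^ 3 := by positivity
  have hK1 : (1 : ℝ) ≤ (Fintype.card V : ℝ) ^ 3 := one_le_pow₀ (by exact_mod_cast hVpos)
  have hexp : (1 - 1 / (Fintype.card V : ℝ) ^ 3) ^ (Fintype.card V ^ 3 * E) ≤ Real.exp (-E) := by
    have h0 : 0 ≤ 1 - 1 / (Fintype.card V : ℝ) ^ 3 := by
      rw [sub_nonneg, div_le_one hK]; exact hK1
    calc _ ≤ Real.exp (-(1 / (Fintype.card V : ℝ) ^ 3)) ^ (Fintype.card V ^ 3 * E) :=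
          pow_le_pow_left₀ h0 (Real.one_sub_le_exp_neg _) _
      _ = _ := by
          rw [← Real.exp_nat_mul]
          congr 1
          push_cast
          field_simp
  have hlt : Real.exp (-E) * (2 : ℝ) ^ E < 1 := by
    rw [Real.exp_neg, inv_mul_lt_iff₀ (Real.exp_pos _), mul_one, ← Real.exp_one_pow]
    exact pow_lt_pow_left₀ (by linarith [Real.exp_one_gt_d9]) (by norm_num) hE.ne'
  have hcard' : (Fintype.card I : ℝ) * (Fintype.card V : ℝ) ^ 3 ≤ 2 ^ E := by exact_mod_cast hcard
  have : (1 : ℝ) < 1 := calc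
    (1 : ℝ) ≤ _ := hterm
    _ ≤ _ := hΦ
    _ ≤ Real.exp (-E) * (2 : ℝ) ^ E := by gcongr
    _ < 1 := hlt
  exact lt_irrefl _ this

/-- A task in a graph with vertex set `Fin m` is determined by the adjacency relation, the table of
the port bijections, the start and the edge. -/
noncomputable def EdgeTask.code {m : ℕ} (τ : EdgeTask (Fin m)) :
    (Fin m → Fin m → Prop) × (Fin m → Fin m → Fin m) × (Fin m × Fin m) × (Fin m × Fin m) :=
  (τ.graph.Adj,
    fun v x => if h : x.1 < τ.ports.deg v then (τ.ports.port v ⟨x, h⟩).1 else v,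
    (τ.start.1, ⟨τ.start.2, τ.start_lt.trans_le (by simpa using τ.ports.deg_le_card τ.start.1)⟩),
    (τ.a, τ.b))

theorem EdgeTask.code_injective {m : ℕ} : Function.Injective (EdgeTask.code (m := m)) := by
  rintro ⟨G, N, ⟨s, p⟩, a, b, hG, hab, hs⟩ ⟨G', N', ⟨s', p'⟩, a', b', hG', hab', hs'⟩ h
  simp only [EdgeTask.code, Prod.mk.injEq, Fin.mk.injEq] at h
  obtain ⟨h1, h2, ⟨rfl, rfl⟩, rfl, rfl⟩ := h
  obtain rfl : G = G' := SimpleGraph.ext h1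
  have hN : N = N' := by
    have hdeg : N.deg = N'.deg := by
      funext v
      have := (N.cast_deg v).trans (N'.cast_deg v).symm
      exact_mod_cast this
    have hle := N.deg_le_card
    obtain ⟨d, f⟩ := N
    obtain ⟨d', f'⟩ := N'
    obtain rfl : d = d' := hdeg
    congr 1
    funext v
    refine Equiv.ext fun x => Subtype.ext ?_
    have := congrFun (congrFun h2 v) ⟨x, x.2.trans_le (by simpa using hle v)⟩
    simpa using this
  subst hN
  rfl

theorem card_task_mul_le (m : ℕ) :
    Nat.card (EdgeTask (Fin m)) * m ^ 3 ≤ 2 ^ (m ^ 3 + m ^ 2 + 7 * m) := by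
  have h1 := Nat.card_le_card_of_injective _ (EdgeTask.code_injective (m := m))
  have h2 : Nat.card ((Fin m → Fin m → Prop) × (Fin m → Fin m → Fin m) × (Fin m × Fin m)
      × (Fin m × Fin m)) = (2 ^ m) ^ m * ((m ^ m) ^ m * (m * m * (m * m))) := by
    simp
  rw [h2] at h1
  have hm : m ≤ 2 ^ m := Nat.lt_two_pow_self.le
  calc _ ≤ (2 ^ m) ^ m * ((m ^ m) ^ m * (m * m * (m * m))) * m ^ 3 := by gcongr
    _ = (2 ^ m) ^ m * (m ^ (m * m + 7)) := by ring
    _ ≤ (2 ^ m) ^ m * ((2 ^ m) ^ (m * m + 7)) := by gcongr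
    _ = _ := by ring

theorem finite_task (m : ℕ) : Finite (EdgeTask (Fin m)) :=
  Finite.of_injective _ (EdgeTask.code_injective (m := m))

/-- For graphs with exactly `m` nodes there is a universal sequence of polynomial length. -/
theorem exists_list_traversesAll (m : ℕ) :
    ∃ S : List ℕ, S.length = m ^ 3 * (m ^ 3 + m ^ 2 + 7 * m) ∧
      ∀ G : SimpleGraph (Fin m), G.Connected → ∀ N : PortNumbering G,
        ∀ s : Fin m × ℕ, s.2 < N.deg s.1 → N.TraversesAll S s := by
  rcases Nat.eq_zero_or_pos m with rfl | hm
  · exact ⟨[], rfl, fun G _ N s => s.1.elim0⟩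
  have := finite_task m
  have := Fintype.ofFinite (EdgeTask (Fin m))
  obtain ⟨S, hS, h⟩ := exists_list_all_done (fun τ : EdgeTask (Fin m) => τ) (m ^ 3 + m ^ 2 + 7 * m)
    (by positivity) (by rw [Fintype.card_fin, ← Nat.card_eq_fintype_card]; exact card_task_mul_le m)
  refine ⟨S, by simpa using hS, fun G hG N s hs e => ?_⟩
  induction e with | _ a b => ?_
  intro hab
  obtain ⟨k, hk, h1, h2⟩ := h ⟨G, N, s, a, b, hG, hab, hs⟩
  refine ⟨k, hk, ?_⟩
  simp only at h1 h2
  rw [h1, h2]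

theorem IsUXS.append {n : ℕ} {S : List ℕ} (h : IsUXS n S) (S' : List ℕ) : IsUXS n (S ++ S') :=
  fun m hm G hG N v p hp => (h m hm G hG N v p hp).append_left _ S'

theorem exists_isUXS (n : ℕ) :
    ∃ S : List ℕ, S.length ≤ n ^ 4 * (n ^ 3 + n ^ 2 + 7 * n) + n ∧ IsUXS n S := by
  suffices h : ∀ k ≤ n, ∃ S : List ℕ, S.length ≤ k * (n ^ 3 * (n ^ 3 + n ^ 2 + 7 * n)) ∧
      IsUXS k S by
    obtain ⟨S, h1, h2⟩ := h n le_rfl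
    exact ⟨S, h1.trans (by nlinarith), h2⟩
  intro k
  induction k with
  | zero => exact fun _ => ⟨[], by simp, fun m hm G _ N v => by
      obtain rfl : m = 0 := by omega
      exact v.elim0⟩
  | succ k ih =>
    intro hk
    obtain ⟨S, hS, h⟩ := ih (by omega)
    obtain ⟨S', hS', h'⟩ := exists_list_traversesAll (k + 1)
    refine ⟨S ++ S', ?_, fun m hm G hG N v p hp => ?_⟩
    · rw [List.length_append, hS', add_mul, one_mul]
      gcongr
    · obtain hm | rfl : m ≤ k ∨ m = k + 1 := by omega
      · exact (h m hm G hG N v p hp).append_left _ _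
      · exact PortNumbering.TraversesAll.append_right _
          (h' G hG N _ (N.walk_snd_lt _ _ hp le_rfl))

theorem exists_polynomial_isUXSFamily :
    ∃ (U : ℕ → List ℕ) (p : Polynomial ℕ), IsUXSFamily U (fun n => p.eval n) := by
  let b : ℕ → ℕ := fun n => n ^ 4 * (n ^ 3 + n ^ 2 + 7 * n) + n
  have h : ∀ u, ∃ S : List ℕ, S.length = u ∧ ∀ n, b n ≤ u → IsUXS n S := by
    intro u
    have hn₀ : b (Nat.findGreatest (fun n => b n ≤ u) u) ≤ u :=
      Nat.findGreatest_spec (P := fun n => b n ≤ u) (Nat.zero_le u) (by simp [b])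
    set n₀ := Nat.findGreatest (fun n => b n ≤ u) u
    obtain ⟨S, hS, h⟩ := exists_isUXS n₀
    refine ⟨S ++ List.replicate (u - S.length) 0, ?_, fun n hn m hm => ?_⟩
    · have : S.length ≤ u := hS.trans hn₀
      simp; omega
    · have hle : n ≤ n₀ := Nat.le_findGreatest ((Nat.le_add_left _ _).trans hn) hn
      exact IsUXS.append h _ m (hm.trans hle)
  choose U hU using h
  refine ⟨U, Polynomial.X ^ 4 * (Polynomial.X ^ 3 + Polynomial.X ^ 2 + 7 * Polynomial.X)
    + Polynomial.X, fun u => (hU u).1, fun n u hu => (hU u).2 n ?_⟩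
  simpa [b] using hu

end GraphRVBF

/-! ### The clock of an agent -/

namespace GraphRVBF

variable {V : Type*} {G : SimpleGraph V}

theorem round_mem (N : PortNumbering G) (U : ℕ → List ℕ) (ℓ : ℕ) (s : AgentState V)
    (fault : Bool) :
    (s.round N U ℓ fault).mem = s.mem.update ℓ ((s.decision N U ℓ).isSome && !fault) := by
  unfold AgentState.round
  cases h : s.decision N U ℓ <;> cases fault <;> simp

theorem round_of_decision_none {N : PortNumbering G} {U : ℕ → List ℕ} {ℓ : ℕ} {s : AgentState V}
    (h : s.decision N U ℓ = none) (fault : Bool) :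
    s.round N U ℓ fault = ⟨s.mem.update ℓ false, s.loc, s.moves⟩ := by
  simp [AgentState.round, h]

theorem decision_eq_none_of_not_busy {N : PortNumbering G} {U : ℕ → List ℕ} {ℓ : ℕ}
    {s : AgentState V} (h : ¬ s.mem.Busy ℓ) : s.decision N U ℓ = none := by
  simp [AgentState.decision, action, h]

theorem run_zero_succ (N : PortNumbering G) (U : ℕ → List ℕ) (ℓ : ℕ) (v : V) (f : ℕ → Bool)
    (τ : ℕ) : run N U ℓ v 0 f (τ + 1) = (run N U ℓ v 0 f τ).round N U ℓ (f τ) := by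
  simp [run]

theorem run_of_le_wake (N : PortNumbering G) (U : ℕ → List ℕ) (ℓ : ℕ) (v : V) {wake t : ℕ}
    (F : ℕ → Bool) (h : t ≤ wake) : run N U ℓ v wake F t = AgentState.initial ℓ v := by
  induction t with
  | zero => rfl
  | succ t ih => rw [run, if_pos (by omega), ih (by omega)]

/-- After its wake-up an agent behaves as if the time started then. -/
theorem run_wake_add (N : PortNumbering G) (U : ℕ → List ℕ) (ℓ : ℕ) (v : V) (wake : ℕ)
    (F : ℕ → Bool) (τ : ℕ) :
    run N U ℓ v wake F (wake + τ) = run N U ℓ v 0 (fun r => F (wake + r)) τ := by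
  induction τ with
  | zero => rw [add_zero, run_of_le_wake _ _ _ _ _ le_rfl]; rfl
  | succ τ ih => rw [← add_assoc, run, if_neg (by omega), ih, run_zero_succ]

/-- The number of rounds of the phases before phase `i`. -/
def phaseStart (i : ℕ) : ℕ := ∑ l ∈ Finset.range i, 2 ^ l * 2 ^ (l + 4)

theorem phaseStart_succ (i : ℕ) : phaseStart (i + 1) = phaseStart i + 2 ^ i * 2 ^ (i + 4) :=
  Finset.sum_range_succ _ _

theorem phaseStart_mono {i j : ℕ} (h : i ≤ j) : phaseStart i ≤ phaseStart j :=
  Finset.sum_le_sum_of_subset (Finset.range_mono h)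

theorem phaseStart_succ_le {i j : ℕ} (h : i < j) : phaseStart (i + 1) ≤ phaseStart j :=
  phaseStart_mono h

/-- The number of rounds between the wake-up of the agent with label `ℓ` and the beginning of its
active stage in phase `i`. -/
def activeStart (ℓ i : ℕ) : ℕ := phaseStart i + ℓ * 2 ^ (i + 4)

/-- The index of the first phase that contains a stage with number `ℓ`. -/
def firstPhase (ℓ : ℕ) : ℕ := Nat.clog 2 (ℓ + 1)

theorem lt_two_pow_iff_firstPhase_le {ℓ i : ℕ} : ℓ < 2 ^ i ↔ firstPhase ℓ ≤ i := by
  rw [firstPhase, Nat.clog_le_iff_le_pow (by norm_num)]; omega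

theorem activeStart_add_le {ℓ i : ℕ} (h : ℓ < 2 ^ i) :
    activeStart ℓ i + 2 ^ (i + 4) ≤ phaseStart (i + 1) := by
  rw [activeStart, phaseStart_succ, add_assoc, ← Nat.succ_mul]
  gcongr; omega

/-- The invariant that relates the memory of an agent to the number `τ` of rounds since its
wake-up, given the sequence `mem` of its memories: phase, stage and tick are determined by `τ`, the
product `c * u` is determined by them, the estimates change at the end of stage `ℓ` only, and the
flags are reset at the beginning of each stage. -/
structure ClockInvariant (ℓ : ℕ) (mem : ℕ → Memory) (τ : ℕ) : Prop where
  time_eq : τ = phaseStart (mem τ).phase + (mem τ).stage * 2 ^ ((mem τ).phase + 4) + (mem τ).tick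
  stage_lt : (mem τ).stage < 2 ^ (mem τ).phase
  tick_lt : (mem τ).tick < 2 ^ ((mem τ).phase + 4)
  mul_eq : (mem τ).stage ≤ ℓ → (mem τ).c * (mem τ).u = 2 ^ max (mem τ).phase (firstPhase ℓ)
  mul_eq' : ℓ < (mem τ).stage → (mem τ).c * (mem τ).u = 2 ^ ((mem τ).phase + 1)
  early : (mem τ).stage ≤ ℓ → (mem τ).phase ≤ firstPhase ℓ →
    (mem τ).u = 1 ∧ (mem τ).c = 2 ^ firstPhase ℓ
  before : (mem τ).stage ≤ ℓ → (mem τ).u = (mem (phaseStart (mem τ).phase)).u ∧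
    (mem τ).c = (mem (phaseStart (mem τ).phase)).c
  after : ℓ < (mem τ).stage →
    (mem τ).u = (mem (activeStart ℓ (mem τ).phase + 2 ^ ((mem τ).phase + 4))).u ∧
    (mem τ).c = (mem (activeStart ℓ (mem τ).phase + 2 ^ ((mem τ).phase + 4))).c
  fresh : (mem τ).tick = 0 →
    (mem τ).success = true ∧ (mem τ).broken = false ∧ (mem τ).moved = false

theorem updateFlags_eq (ℓ : ℕ) (m : Memory) (b : Bool) : ∃ x y z,
    m.updateFlags ℓ b = ⟨m.phase, m.stage, m.tick, m.u, m.c, x, y, z⟩ := by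
  unfold Memory.updateFlags
  dsimp only
  split_ifs <;> exact ⟨_, _, _, rfl⟩

theorem ClockInvariant.stageLength_eq {ℓ : ℕ} {mem : ℕ → Memory} {τ : ℕ}
    (h : ClockInvariant ℓ mem τ) : (mem τ).stageLength ℓ = 2 ^ ((mem τ).phase + 4) := by
  unfold Memory.stageLength
  split_ifs with hs
  · rw [h.mul_eq hs.le, max_eq_left (lt_two_pow_iff_firstPhase_le.1 (hs ▸ h.stage_lt))]
    ring
  · rfl

theorem ClockInvariant.succ {ℓ : ℕ} {mem : ℕ → Memory} {τ : ℕ} (h : ClockInvariant ℓ mem τ)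
    {b : Bool} (hstep : mem (τ + 1) = (mem τ).update ℓ b) : ClockInvariant ℓ mem (τ + 1) := by
  obtain ⟨x, y, z, hflags⟩ := updateFlags_eq ℓ (mem τ) b
  rw [Memory.update, hflags, Memory.advance] at hstep
  have hlen : Memory.stageLength ℓ ⟨(mem τ).phase, (mem τ).stage, (mem τ).tick, (mem τ).u,
      (mem τ).c, x, y, z⟩ = 2 ^ ((mem τ).phase + 4) := h.stageLength_eq
  simp only [hlen] at hstep
  have ht := h.time_eq
  have h1 := h.stage_lt
  have h2 := h.tick_lt
  have h3 := h.mul_eq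
  have h4 := h.mul_eq'
  have h5 := h.early
  have h6 := h.before
  have h7 := h.after
  by_cases hlast : (mem τ).tick + 1 < 2 ^ ((mem τ).phase + 4)
  · rw [if_pos hlast] at hstep
    constructor <;> simp only [hstep] <;> first | assumption | omega
  rw [if_neg hlast] at hstep
  have htick : (mem τ).tick + 1 = 2 ^ ((mem τ).phase + 4) := by omega
  generalize hi : (mem τ).phase = i at *
  generalize hj : (mem τ).stage = j at *
  by_cases hst : j + 1 < 2 ^ i
  · simp only [if_pos hst] at hstep
    have htime : τ + 1 = phaseStart i + (j + 1) * 2 ^ (i + 4) := by rw [add_mul]; omega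
    have hafter : j = ℓ → τ + 1 = activeStart ℓ i + 2 ^ (i + 4) := by
      rintro rfl; rw [htime, activeStart, add_mul]; omega
    have hmul : j = ℓ → (mem τ).c * (mem τ).u = 2 ^ i := by
      rintro rfl
      rw [h3 le_rfl, max_eq_left (lt_two_pow_iff_firstPhase_le.1 h1)]
    constructor
    · simp only [hstep]; omega
    · simp only [hstep]; exact hst
    · simp only [hstep]; positivity
    · simp only [hstep]
      intro hle
      rw [if_neg (by omega), if_neg (by omega)]
      exact h3 (by omega)
    · simp only [hstep]
      intro hlt
      by_cases hjl : j = ℓ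
      · cases x <;> simp only [hjl, true_and, Bool.false_eq_true, if_true, if_false,
          Bool.true_eq_false] <;> rw [pow_succ, ← hmul hjl] <;> ring
      · simp only [hjl, false_and, if_false]
        exact h4 (by omega)
    · simp only [hstep]
      intro hle
      rw [if_neg (by omega), if_neg (by omega)]
      exact h5 (by omega)
    · intro hle
      simp only [hstep] at hle ⊢
      rw [if_neg (by omega), if_neg (by omega)]
      exact h6 (by omega)
    · intro hlt
      by_cases hjl : j = ℓ
      · have e1 : (mem (τ + 1)).phase = i := by rw [hstep]
        rw [e1, ← hafter hjl]
        exact ⟨rfl, rfl⟩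
      · simp only [hstep] at hlt ⊢
        simp only [hjl, false_and, if_false]
        exact h7 (by omega)
    · simp [hstep]
  · simp only [if_neg hst] at hstep
    have hj1 : j + 1 = 2 ^ i := by omega
    have htime : τ + 1 = phaseStart (i + 1) := by
      rw [phaseStart_succ, ← hj1, add_mul]; omega
    have e1 : (mem (τ + 1)).phase = i + 1 := by rw [hstep]
    have e2 : (mem (τ + 1)).stage = 0 := by rw [hstep]
    constructor
    · rw [e1, e2, htime, ← htime, hstep]; simp
    · rw [e2]; positivity
    · rw [hstep]; positivity
    · rw [e1]
      intro _
      simp only [hstep]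
      rcases lt_trichotomy j ℓ with hjl | hjl | hjl
      · have : ¬ firstPhase ℓ ≤ i := by rw [← lt_two_pow_iff_firstPhase_le]; omega
        simp only [hjl.ne, false_and, if_false]
        rw [h3 hjl.le]
        congr 1; omega
      · have h8 := h3 hjl.le
        have : firstPhase ℓ ≤ i := by rw [← lt_two_pow_iff_firstPhase_le]; omega
        rw [max_eq_left this] at h8
        rw [max_eq_left (by omega), pow_succ, ← h8]
        cases x <;> simp [hjl] <;> ring
      · have : firstPhase ℓ ≤ i := by rw [← lt_two_pow_iff_firstPhase_le]; omega
        simp only [hjl.ne', false_and, if_false]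
        rw [h4 hjl, max_eq_left (by omega)]
    · rw [e2]; omega
    · rw [e1]
      intro _ hle
      have hlt : ¬ ℓ < 2 ^ i := by rw [lt_two_pow_iff_firstPhase_le]; omega
      have hjl : j ≠ ℓ := by omega
      simp only [hstep, hjl, false_and, if_false]
      exact h5 (by omega) (by omega)
    · rw [e1, ← htime]
      exact fun _ => ⟨rfl, rfl⟩
    · rw [e2]; omega
    · simp [hstep]

theorem phaseStart_zero : phaseStart 0 = 0 := rfl

theorem clockInvariant_run (N : PortNumbering G) (U : ℕ → List ℕ) (ℓ : ℕ) (v : V) (f : ℕ → Bool)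
    (τ : ℕ) : ClockInvariant ℓ (fun τ => (run N U ℓ v 0 f τ).mem) τ := by
  induction τ with
  | zero =>
    constructor <;> simp [run, AgentState.initial, Memory.initial, phaseStart_zero, firstPhase]
  | succ τ ih =>
    refine ih.succ (b := (((run N U ℓ v 0 f τ).decision N U ℓ).isSome && !f τ)) ?_
    simp only [run_zero_succ, round_mem]

/-- The time determines phase, stage and tick. -/
theorem clock_unique {i j k i' j' k' : ℕ} (hj : j < 2 ^ i) (hk : k < 2 ^ (i + 4))
    (hj' : j' < 2 ^ i') (hk' : k' < 2 ^ (i' + 4))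
    (h : phaseStart i + j * 2 ^ (i + 4) + k = phaseStart i' + j' * 2 ^ (i' + 4) + k') :
    i = i' ∧ j = j' ∧ k = k' := by
  have hlt : ∀ {i j k i' j' k' : ℕ}, j < 2 ^ i → k < 2 ^ (i + 4) →
      phaseStart i + j * 2 ^ (i + 4) + k = phaseStart i' + j' * 2 ^ (i' + 4) + k' → ¬ i < i' := by
    intro i j k i' j' k' hj hk h hlt
    have h1 := phaseStart_succ_le hlt
    have h2 := activeStart_add_le hj
    rw [activeStart] at h2
    omega
  obtain rfl : i = i' := le_antisymm (not_lt.1 (hlt hj' hk' h.symm)) (not_lt.1 (hlt hj hk h))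
  have h1 : j * 2 ^ (i + 4) + k = j' * 2 ^ (i + 4) + k' := by omega
  have hp : 0 < 2 ^ (i + 4) := by positivity
  have h2 : j = j' := by
    have := congrArg (· / 2 ^ (i + 4)) h1
    simpa [Nat.add_div_of_dvd_right, Nat.mul_add_div, mul_comm _ (2 ^ (i + 4)),
      Nat.div_eq_of_lt hk, Nat.div_eq_of_lt hk'] using this
  subst h2
  exact ⟨rfl, rfl, by omega⟩

/-- The clock at the beginning of a stage. -/
theorem run_mem_stage (N : PortNumbering G) (U : ℕ → List ℕ) (ℓ : ℕ) (v : V) (f : ℕ → Bool)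
    {i j : ℕ} (hj : j < 2 ^ i) : ∃ u c,
    (run N U ℓ v 0 f (phaseStart i + j * 2 ^ (i + 4))).mem = ⟨i, j, 0, u, c, true, false, false⟩ := by
  have h := clockInvariant_run N U ℓ v f (phaseStart i + j * 2 ^ (i + 4))
  obtain ⟨h1, h2, h3⟩ := clock_unique (k := 0) hj (by positivity) h.stage_lt h.tick_lt h.time_eq
  obtain ⟨h4, h5, h6⟩ := h.fresh h3.symm
  generalize (run N U ℓ v 0 f (phaseStart i + j * 2 ^ (i + 4))).mem = m at *
  obtain ⟨_, _, _, u, c, _, _, _⟩ := m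
  simp only at h1 h2 h3 h4 h5 h6
  subst h1 h2 h3 h4 h5 h6
  exact ⟨u, c, rfl⟩

end GraphRVBF

/-! ### The active stage of a phase -/

namespace GraphRVBF

variable {V : Type*} {G : SimpleGraph V}

theorem update_busy {ℓ i t u c : ℕ} {σ β μ : Bool} (ht : t < 3 * (c * u)) (arrived : Bool) :
    Memory.update ℓ ⟨i, ℓ, t, u, c, σ, β, μ⟩ arrived =
      if (t + 1) % c = 0 then ⟨i, ℓ, t + 1, u, c, σ && (μ || arrived),
        if (t + 1) % (c * u) = 0 then false else β || !(μ || arrived), false⟩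
      else ⟨i, ℓ, t + 1, u, c, σ, β, μ || arrived⟩ := by
  have hlt : t + 1 < 3 * (c * u) + 13 * 2 ^ i := by
    have : 0 < 2 ^ i := by positivity
    omega
  unfold Memory.update Memory.updateFlags
  by_cases h : (t + 1) % c = 0 <;>
    simp [Memory.Busy, Memory.advance, Memory.stageLength, ht, h, hlt]

theorem update_idle {ℓ i t u c : ℕ} {σ β μ : Bool} (ht : 3 * (c * u) ≤ t)
    (ht' : t + 1 < 3 * (c * u) + 13 * 2 ^ i) :
    Memory.update ℓ ⟨i, ℓ, t, u, c, σ, β, μ⟩ false = ⟨i, ℓ, t + 1, u, c, σ, β, μ⟩ := by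
  unfold Memory.update Memory.updateFlags
  simp [Memory.Busy, Memory.advance, Memory.stageLength, not_lt.2 ht, ht']

/-- The agent is never delayed in more than `cb` consecutive rounds (time counted from its
wake-up). -/
def DelayBound (N : PortNumbering G) (U : ℕ → List ℕ) (ℓ : ℕ) (v : V) (f : ℕ → Bool) (cb : ℕ) :
    Prop :=
  ∀ τ, ∃ k ≤ cb, ¬ (((run N U ℓ v 0 f (τ + k)).decision N U ℓ).isSome = true ∧ f (τ + k) = true)

theorem FaultBounded.delayBound {N : PortNumbering G} {U : ℕ → List ℕ} {ℓ : ℕ} {v : V} {wake : ℕ}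
    {F : ℕ → Bool} {cb : ℕ} (h : FaultBounded N U ℓ v wake F cb) :
    DelayBound N U ℓ v (fun r => F (wake + r)) cb := by
  intro τ
  obtain ⟨k, hk, hd⟩ := h (wake + τ)
  refine ⟨k, hk, fun hd' => hd ⟨by omega, ?_, ?_⟩⟩
  · rw [add_assoc, run_wake_add]; exact hd'.1
  · rw [add_assoc]; exact hd'.2

/-- The location to which step `k` of an exploration with parameter `u` leads from `s`. -/
def stepTarget (N : PortNumbering G) (U : ℕ → List ℕ) (u : ℕ) (s : V × ℕ) (k : ℕ) : V × ℕ :=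
  N.cross s ((s.2 + (U u).getD k 0) % N.deg s.1)

variable (N : PortNumbering G) (U : ℕ → List ℕ) (ℓ : ℕ) (v : V) (f : ℕ → Bool)

/-- One step of an exploration: the agent makes at most one move, in the round with offset `k`
(no move if `k = c`). If it has not failed before, it moves unless it is delayed in all `c` rounds
of the step. -/
theorem run_step {cb i b u c τ : ℕ} {σ β : Bool} (hF : DelayBound N U ℓ v f cb) (hc : 0 < c)
    (hb : c ∣ b) (hbu : b + c ≤ 3 * (c * u))
    (hmem : (run N U ℓ v 0 f τ).mem = ⟨i, ℓ, b, u, c, σ, β, false⟩) :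
    ∃ k ≤ c, (β = true → k = c) ∧ (k = c → β = false → c ≤ cb) ∧
      (∀ r < c, run N U ℓ v 0 f (τ + r) = ⟨⟨i, ℓ, b + r, u, c, σ, β, decide (k < r)⟩,
        if k < r then stepTarget N U u (run N U ℓ v 0 f τ).loc (b % (c * u) / c)
          else (run N U ℓ v 0 f τ).loc,
        (run N U ℓ v 0 f τ).moves + if k < r then 1 else 0⟩) ∧
      run N U ℓ v 0 f (τ + c) = ⟨⟨i, ℓ, b + c, u, c, σ && decide (k < c),
          if (b + c) % (c * u) = 0 then false else β || !decide (k < c), false⟩,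
        if k < c then stepTarget N U u (run N U ℓ v 0 f τ).loc (b % (c * u) / c)
          else (run N U ℓ v 0 f τ).loc,
        (run N U ℓ v 0 f τ).moves + if k < c then 1 else 0⟩ := by
  obtain ⟨a, rfl⟩ := hb
  obtain ⟨k, hkc, hkβ, hk1, hk2⟩ : ∃ k ≤ c, (β = true → k = c) ∧
      (∀ r < c, β = false → r < k → f (τ + r) = true) ∧ (k < c → f (τ + k) = false) := by
    cases β with
    | true => exact ⟨c, le_rfl, fun _ => rfl, by simp, by simp⟩
    | false =>
      by_cases h : ∃ r, r < c ∧ f (τ + r) = false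
      · refine ⟨Nat.find h, (Nat.find_spec h).1.le, by simp, fun r hr _ hrk => ?_,
          fun _ => (Nat.find_spec h).2⟩
        have := Nat.find_min h hrk
        simpa [hr] using this
      · push Not at h
        exact ⟨c, le_rfl, by simp, fun r hr _ _ => by simpa using h r hr, by simp⟩
  set s := run N U ℓ v 0 f τ with hs
  set target := stepTarget N U u s.loc (c * a % (c * u) / c) with htarget
  -- the state after the round with offset `r`, up to the bookkeeping at the end of the step
  have hround : ∀ r < c, run N U ℓ v 0 f (τ + r) = ⟨⟨i, ℓ, c * a + r, u, c, σ, β, decide (k < r)⟩,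
        if k < r then target else s.loc, s.moves + if k < r then 1 else 0⟩ →
      ((run N U ℓ v 0 f (τ + r)).decision N U ℓ = if β = false ∧ ¬ k < r then
          some ((s.loc.2 + (U u).getD (c * a % (c * u) / c) 0) % N.deg s.loc.1) else none) ∧
      run N U ℓ v 0 f (τ + (r + 1)) =
        ⟨Memory.update ℓ ⟨i, ℓ, c * a + r, u, c, σ, β, decide (k < r)⟩ (decide (r = k)),
        if k < r + 1 then target else s.loc, s.moves + if k < r + 1 then 1 else 0⟩ := by
    intro r hr h
    have hbusy : c * a + r < 3 * (c * u) := by omega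
    have hidx : (c * a + r) % (c * u) / c = c * a % (c * u) / c := by
      rw [Nat.mod_mul_right_div_self, Nat.mod_mul_right_div_self, Nat.mul_add_div hc,
        Nat.div_eq_of_lt hr, add_zero, Nat.mul_div_cancel_left _ hc]
    have hdec : (run N U ℓ v 0 f (τ + r)).decision N U ℓ = if β = false ∧ ¬ k < r then
          some ((s.loc.2 + (U u).getD (c * a % (c * u) / c) 0) % N.deg s.loc.1) else none := by
      rw [h]
      simp only [AgentState.decision, action, Memory.Busy, Memory.stepIndex, hbusy, hidx]
      by_cases hkr : k < r
      · simp [hkr]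
      · simp [hkr]
    refine ⟨hdec, ?_⟩
    rw [← add_assoc, run_zero_succ]
    unfold AgentState.round
    rw [hdec]
    rcases lt_trichotomy k r with hkr | hkr | hkr
    · have h1 : ¬ r = k := by omega
      simp [hkr, h, h1, Nat.lt_succ_of_lt hkr]
    · subst hkr
      have hβ : β = false := by
        cases β with
        | false => rfl
        | true => have := hkβ rfl; omega
      simp [h, hβ, hk2 hr, htarget, stepTarget]
    · have h1 : ¬ r = k := by omega
      have h2 : ¬ k < r := by omega
      have h3 : ¬ k < r + 1 := by omega
      cases β with
      | true => simp [h, h1, h2, h3]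
      | false => simp [h, h1, h2, h3, hk1 r hr rfl hkr]
  have hmod : ∀ r, (c * a + r) % c = r % c := fun r => Nat.mul_add_mod _ _ _
  have hstate : ∀ r < c, run N U ℓ v 0 f (τ + r) = ⟨⟨i, ℓ, c * a + r, u, c, σ, β, decide (k < r)⟩,
        if k < r then target else s.loc, s.moves + if k < r then 1 else 0⟩ := by
    intro r
    induction r with
    | zero =>
      intro _
      simp only [add_zero, Nat.not_lt_zero, decide_false, if_false, ← hmem]
      rfl
    | succ r ih =>
      intro hr
      rw [(hround r (by omega) (ih (by omega))).2, update_busy (by omega), add_assoc, hmod,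
        Nat.mod_eq_of_lt hr, if_neg (by omega)]
      have : (decide (k < r) || decide (r = k)) = decide (k < r + 1) := by
        rw [← Bool.decide_or]; congr 1; simp only [eq_iff_iff]; omega
      rw [this]
  refine ⟨k, hkc, hkβ, fun hk hβ => ?_, hstate, ?_⟩
  · -- all rounds of the step are delayed
    by_contra hcb
    obtain ⟨r, hr, hd⟩ := hF τ
    have hrc : r < c := by omega
    refine hd ⟨?_, hk1 r hrc hβ (by omega)⟩
    rw [(hround r hrc (hstate r hrc)).1, if_pos ⟨hβ, by omega⟩]
    rfl
  · obtain ⟨c', rfl⟩ : ∃ c', c = c' + 1 := ⟨c - 1, by omega⟩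
    rw [(hround c' (by omega) (hstate c' (by omega))).2, update_busy (by omega), add_assoc, hmod,
      Nat.mod_self, if_pos rfl]
    have : (decide (k < c') || decide (c' = k)) = decide (k < c' + 1) := by
      rw [← Bool.decide_or]; congr 1; simp only [eq_iff_iff]; omega
    rw [this]

/-- An exploration up to the beginning of its step `a`. -/
theorem run_exploration {cb i e u c τ : ℕ} {σ : Bool} (hF : DelayBound N U ℓ v f cb) (hc : 0 < c)
    (he : e < 3) (hU : (U u).length = u)
    (hmem : (run N U ℓ v 0 f τ).mem = ⟨i, ℓ, e * (c * u), u, c, σ, false, false⟩) {a : ℕ}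
    (ha : a ≤ u) : ∃ σ' β,
      (run N U ℓ v 0 f (τ + c * a)).mem = ⟨i, ℓ, e * (c * u) + c * a, u, c, σ', β, false⟩ ∧
      (a = u → β = false) ∧
      (run N U ℓ v 0 f (τ + c * a)).moves ≤ (run N U ℓ v 0 f τ).moves + a ∧
      (cb < c → σ' = σ ∧ β = false) ∧
      (σ' = true → σ = true ∧ β = false ∧ ∀ k ≤ a,
        (run N U ℓ v 0 f (τ + c * k)).loc = N.walk (U u) (run N U ℓ v 0 f τ).loc k) := by
  induction a with
  | zero =>
    refine ⟨σ, false, by simpa using hmem, fun _ => rfl, by simp, by simp, fun h => ⟨h, rfl, ?_⟩⟩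
    intro k hk
    obtain rfl : k = 0 := by omega
    simp [PortNumbering.walk_zero]
  | succ a ih =>
    obtain ⟨σ', β, h1, -, h3, h4, h5⟩ := ih (by omega)
    have hcau : c * a + c ≤ c * u := by rw [← Nat.mul_succ]; exact Nat.mul_le_mul_left _ ha
    have hecu : e * (c * u) ≤ 2 * (c * u) := Nat.mul_le_mul_right _ (by omega)
    have hbound : e * (c * u) + c * a + c ≤ 3 * (c * u) := by omega
    obtain ⟨k, hk, hkβ, hkcb, -, hend⟩ := run_step N U ℓ v f hF hc
      ⟨e * u + a, by ring⟩ hbound h1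
    have hidx : (e * (c * u) + c * a) % (c * u) / c = a := by
      rw [mul_comm e, Nat.mul_add_mod, Nat.mod_eq_of_lt (by omega), Nat.mul_div_cancel_left _ hc]
    rw [hidx, add_assoc τ, ← Nat.mul_succ, Nat.succ_eq_add_one] at hend
    rw [hend]
    refine ⟨_, _, by rw [add_assoc _ (c * a), ← Nat.mul_succ], fun hau => ?_, ?_, fun hcb => ?_,
      fun hσ => ?_⟩
    · rw [if_pos]
      rw [Nat.succ_eq_add_one, hau, ← Nat.succ_mul]
      exact Nat.mul_mod_left _ _
    · dsimp only; split_ifs <;> omega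
    · obtain ⟨rfl, rfl⟩ := h4 hcb
      have : k < c := lt_of_le_of_ne hk fun h => absurd (hkcb h rfl) (by omega)
      simp [this]
    · rw [Bool.and_eq_true, decide_eq_true_eq] at hσ
      obtain ⟨h6, h7, h8⟩ := h5 hσ.1
      refine ⟨h6, by simp [h7, hσ.2], fun k' hk' => ?_⟩
      obtain hlt | rfl : k' ≤ a ∨ k' = a + 1 := by omega
      · exact h8 k' hlt
      · rw [hend, if_pos hσ.2, N.walk_succ _ _ (by omega), h8 a le_rfl]
        rfl

end GraphRVBF

/-! ### The estimates of the phases -/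

namespace GraphRVBF

variable {V : Type*} {G : SimpleGraph V}
variable (N : PortNumbering G) (U : ℕ → List ℕ) (ℓ : ℕ) (v : V) (f : ℕ → Bool)

/-- The estimate `u` of the agent in phase `i`. -/
def phaseU (i : ℕ) : ℕ := (run N U ℓ v 0 f (phaseStart i)).mem.u

/-- The estimate `c` of the agent in phase `i`. -/
def phaseC (i : ℕ) : ℕ := (run N U ℓ v 0 f (phaseStart i)).mem.c

/-- The success flag at the end of the three explorations of phase `i`. -/
def PhaseSuccess (i : ℕ) : Prop :=
  (run N U ℓ v 0 f (activeStart ℓ i + 3 * 2 ^ i)).mem.success = true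

variable {ℓ}

theorem run_mem_activeStart {i : ℕ} (hi : ℓ < 2 ^ i) :
    (run N U ℓ v 0 f (activeStart ℓ i)).mem =
      ⟨i, ℓ, 0, phaseU N U ℓ v f i, phaseC N U ℓ v f i, true, false, false⟩ := by
  obtain ⟨u, c, h⟩ := run_mem_stage N U ℓ v f hi
  have h1 := (clockInvariant_run N U ℓ v f (activeStart ℓ i)).before
  rw [← activeStart] at h
  simp only [h] at h1
  obtain ⟨h2, h3⟩ := h1 le_rfl
  rw [h, phaseU, phaseC, ← h2, ← h3]

theorem phaseC_mul_phaseU {i : ℕ} (hi : ℓ < 2 ^ i) :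
    phaseC N U ℓ v f i * phaseU N U ℓ v f i = 2 ^ i := by
  have h := (clockInvariant_run N U ℓ v f (activeStart ℓ i)).mul_eq
  simp only [run_mem_activeStart N U v f hi] at h
  rw [h le_rfl, max_eq_left (lt_two_pow_iff_firstPhase_le.1 hi)]

theorem phaseC_pos {i : ℕ} (hi : ℓ < 2 ^ i) : 0 < phaseC N U ℓ v f i :=
  Nat.pos_of_ne_zero fun h => by
    have := phaseC_mul_phaseU N U v f hi
    rw [h, zero_mul] at this
    exact absurd this (by positivity)

theorem phaseU_firstPhase : phaseU N U ℓ v f (firstPhase ℓ) = 1 ∧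
    phaseC N U ℓ v f (firstPhase ℓ) = 2 ^ firstPhase ℓ := by
  have hi : ℓ < 2 ^ firstPhase ℓ := lt_two_pow_iff_firstPhase_le.2 le_rfl
  have h := (clockInvariant_run N U ℓ v f (activeStart ℓ (firstPhase ℓ))).early
  simp only [run_mem_activeStart N U v f hi] at h
  exact h le_rfl le_rfl

/-- The three explorations of phase `i`, up to the beginning of exploration `e`. -/
theorem run_explorations {cb i : ℕ} (hF : DelayBound N U ℓ v f cb)
    (hU : ∀ u, (U u).length = u) (hi : ℓ < 2 ^ i) {e : ℕ} (he : e ≤ 3) : ∃ σ,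
      (run N U ℓ v 0 f (activeStart ℓ i + e * 2 ^ i)).mem =
        ⟨i, ℓ, e * 2 ^ i, phaseU N U ℓ v f i, phaseC N U ℓ v f i, σ, false, false⟩ ∧
      (run N U ℓ v 0 f (activeStart ℓ i + e * 2 ^ i)).moves
        ≤ (run N U ℓ v 0 f (activeStart ℓ i)).moves + e * phaseU N U ℓ v f i ∧
      (cb < phaseC N U ℓ v f i → σ = true) ∧
      (σ = true → ∀ e' < e, ∀ k ≤ phaseU N U ℓ v f i,
        (run N U ℓ v 0 f (activeStart ℓ i + e' * 2 ^ i + phaseC N U ℓ v f i * k)).loc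
          = N.walk (U (phaseU N U ℓ v f i))
            (run N U ℓ v 0 f (activeStart ℓ i + e' * 2 ^ i)).loc k) := by
  have hcu := phaseC_mul_phaseU N U v f hi
  have hc := phaseC_pos N U v f hi
  induction e with
  | zero => exact ⟨true, by simpa using run_mem_activeStart N U v f hi, by simp, by simp, by simp⟩
  | succ e ih =>
    obtain ⟨σ, h1, h2, h3, h4⟩ := ih (by omega)
    rw [← hcu] at h1
    obtain ⟨σ', β, h5, h6, h7, h8, h9⟩ := run_exploration N U ℓ v f hF hc (by omega) (hU _) h1 le_rfl
    have ht : activeStart ℓ i + e * 2 ^ i + phaseC N U ℓ v f i * phaseU N U ℓ v f i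
        = activeStart ℓ i + (e + 1) * 2 ^ i := by rw [hcu]; ring
    rw [hcu] at ht h5 h7 h9
    rw [ht] at h5 h7
    refine ⟨σ', ?_, ?_, fun hcb => ?_, fun hσ e' he' => ?_⟩
    · rw [h5, h6 rfl, Nat.succ_mul]
    · rw [Nat.succ_mul e (phaseU N U ℓ v f i)]; omega
    · rw [(h8 hcb).1, h3 hcb]
    · obtain ⟨h10, -, h11⟩ := h9 hσ
      obtain hlt | rfl : e' < e ∨ e' = e := by omega
      · exact h4 h10 e' hlt
      · exact h11

theorem phaseSuccess_iff {cb i : ℕ} (hF : DelayBound N U ℓ v f cb)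
    (hU : ∀ u, (U u).length = u) (hi : ℓ < 2 ^ i) :
    ∃ σ, (PhaseSuccess N U ℓ v f i ↔ σ = true) ∧
      (run N U ℓ v 0 f (activeStart ℓ i + 3 * 2 ^ i)).mem =
        ⟨i, ℓ, 3 * 2 ^ i, phaseU N U ℓ v f i, phaseC N U ℓ v f i, σ, false, false⟩ := by
  obtain ⟨σ, h1, -⟩ := run_explorations N U v f hF hU hi le_rfl
  exact ⟨σ, by rw [PhaseSuccess, h1], h1⟩

theorem phaseC_le_of_not_success {cb i : ℕ} (hF : DelayBound N U ℓ v f cb)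
    (hU : ∀ u, (U u).length = u) (hi : ℓ < 2 ^ i) (h : ¬ PhaseSuccess N U ℓ v f i) :
    phaseC N U ℓ v f i ≤ cb := by
  obtain ⟨σ, h1, -, h2, -⟩ := run_explorations N U v f hF hU hi le_rfl
  rw [PhaseSuccess, h1] at h
  exact not_lt.1 fun hlt => h (h2 hlt)

/-- The idle rounds after the explorations preserve the success flag. -/
theorem run_mem_idle {cb i : ℕ} (hF : DelayBound N U ℓ v f cb)
    (hU : ∀ u, (U u).length = u) (hi : ℓ < 2 ^ i) : ∃ σ, (PhaseSuccess N U ℓ v f i ↔ σ = true) ∧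
    ∀ r < 13 * 2 ^ i, (run N U ℓ v 0 f (activeStart ℓ i + 3 * 2 ^ i + r)).mem =
      ⟨i, ℓ, 3 * 2 ^ i + r, phaseU N U ℓ v f i, phaseC N U ℓ v f i, σ, false, false⟩ := by
  obtain ⟨σ, hσ, h⟩ := phaseSuccess_iff N U v f hF hU hi
  refine ⟨σ, hσ, fun r => ?_⟩
  have hcu := phaseC_mul_phaseU N U v f hi
  induction r with
  | zero => exact fun _ => h
  | succ r ih =>
    intro hr
    have h1 := ih (by omega)
    have h2 : ¬ (run N U ℓ v 0 f (activeStart ℓ i + 3 * 2 ^ i + r)).mem.Busy ℓ := by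
      rw [h1]; simp [Memory.Busy, hcu]
    rw [← add_assoc, run_zero_succ, round_of_decision_none (decision_eq_none_of_not_busy h2)]
    dsimp only
    rw [h1, update_idle (by omega) (by omega), add_assoc]

theorem update_u_c_of_ne {m : Memory} (h : m.stage ≠ ℓ) (b : Bool) :
    (m.update ℓ b).u = m.u ∧ (m.update ℓ b).c = m.c := by
  obtain ⟨x, y, z, hflags⟩ := updateFlags_eq ℓ m b
  rw [Memory.update, hflags, Memory.advance]
  simp only [h, false_and, if_false]
  split_ifs <;> exact ⟨rfl, rfl⟩

/-- The change of the estimates from phase `i` to the next phase. -/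
theorem phase_succ_eq {cb i : ℕ} (hF : DelayBound N U ℓ v f cb)
    (hU : ∀ u, (U u).length = u) (hi : ℓ < 2 ^ i) :
    (PhaseSuccess N U ℓ v f i → phaseU N U ℓ v f (i + 1) = 2 * phaseU N U ℓ v f i ∧
      phaseC N U ℓ v f (i + 1) = phaseC N U ℓ v f i) ∧
    (¬ PhaseSuccess N U ℓ v f i → phaseU N U ℓ v f (i + 1) = phaseU N U ℓ v f i ∧
      phaseC N U ℓ v f (i + 1) = 2 * phaseC N U ℓ v f i) := by
  obtain ⟨σ, hσ, h⟩ := run_mem_idle N U v f hF hU hi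
  have hcu := phaseC_mul_phaseU N U v f hi
  have hpow : 2 ^ (i + 4) = 3 * 2 ^ i + (13 * 2 ^ i - 1) + 1 := by
    have : 0 < 2 ^ i := by positivity
    rw [pow_add]; omega
  -- the estimates at the end of the active stage
  have hend : (run N U ℓ v 0 f (activeStart ℓ i + 2 ^ (i + 4))).mem.u
        = (if σ = true then 2 * phaseU N U ℓ v f i else phaseU N U ℓ v f i) ∧
      (run N U ℓ v 0 f (activeStart ℓ i + 2 ^ (i + 4))).mem.c
        = (if σ = false then 2 * phaseC N U ℓ v f i else phaseC N U ℓ v f i) := by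
    have h1 := h (13 * 2 ^ i - 1) (by have : 0 < 2 ^ i := by positivity
                                      omega)
    have h2 : ¬ (run N U ℓ v 0 f
        (activeStart ℓ i + 3 * 2 ^ i + (13 * 2 ^ i - 1))).mem.Busy ℓ := by
      rw [h1]; simp [Memory.Busy, hcu]
    rw [hpow, ← add_assoc, ← add_assoc, run_zero_succ,
      round_of_decision_none (decision_eq_none_of_not_busy h2)]
    dsimp only
    rw [h1]
    have h3 : 3 * 2 ^ i ≤ 3 * 2 ^ i + (13 * 2 ^ i - 1) := by omega
    have h4 : 3 * 2 ^ i + 13 * 2 ^ i ≤ 3 * 2 ^ i + (13 * 2 ^ i - 1) + 1 := by omega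
    unfold Memory.update Memory.updateFlags
    simp [Memory.Busy, Memory.advance, Memory.stageLength, hcu, not_lt.2 h3, not_lt.2 h4]
  -- they do not change until the end of the phase
  have hsucc : phaseU N U ℓ v f (i + 1)
        = (run N U ℓ v 0 f (activeStart ℓ i + 2 ^ (i + 4))).mem.u ∧
      phaseC N U ℓ v f (i + 1)
        = (run N U ℓ v 0 f (activeStart ℓ i + 2 ^ (i + 4))).mem.c := by
    rcases (activeStart_add_le hi).eq_or_lt with heq | hlt
    · rw [heq]; exact ⟨rfl, rfl⟩
    · have hp : 0 < 2 ^ i * 2 ^ (i + 4) := by positivity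
      have hps := phaseStart_succ i
      have hI := clockInvariant_run N U ℓ v f (phaseStart (i + 1) - 1)
      have hq : 2 ^ i * 2 ^ (i + 4) = (2 ^ i - 1) * 2 ^ (i + 4) + (2 ^ (i + 4) - 1) + 1 := by
        have h1 : 0 < 2 ^ (i + 4) := by positivity
        have h2 : 1 * 2 ^ (i + 4) ≤ 2 ^ i * 2 ^ (i + 4) :=
          Nat.mul_le_mul_right _ (Nat.one_le_two_pow)
        rw [Nat.sub_mul]; omega
      obtain ⟨e1, e2, -⟩ := clock_unique (i := i) (j := 2 ^ i - 1) (k := 2 ^ (i + 4) - 1)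
        (Nat.sub_lt (by positivity) one_pos) (Nat.sub_lt (by positivity) one_pos)
        hI.stage_lt hI.tick_lt (by rw [← hI.time_eq]; omega)
      have hstage : ℓ + 1 ≠ 2 ^ i := by
        intro heq
        rw [activeStart, phaseStart_succ, ← heq, Nat.succ_mul] at hlt
        omega
      obtain ⟨h3, h4⟩ := hI.after (by rw [← e2]; omega)
      have h5 : phaseStart (i + 1) = phaseStart (i + 1) - 1 + 1 := by omega
      obtain ⟨h6, h7⟩ := update_u_c_of_ne (ℓ := ℓ)
        (m := (run N U ℓ v 0 f (phaseStart (i + 1) - 1)).mem) (by rw [← e2]; omega)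
        (((run N U ℓ v 0 f (phaseStart (i + 1) - 1)).decision N U ℓ).isSome
          && !f (phaseStart (i + 1) - 1))
      rw [← round_mem, ← run_zero_succ, ← h5] at h6 h7
      rw [← e1] at h3 h4
      exact ⟨h6.trans h3, h7.trans h4⟩
  rw [hsucc.1, hsucc.2, hend.1, hend.2, hσ]
  constructor
  · intro h; simp [h]
  · intro h; simp [h]

/-! ### Moves of an agent -/

/-- An agent moves only during the explorations. -/
theorem exists_phase_of_run_ne {τ : ℕ}
    (h : (run N U ℓ v 0 f (τ + 1)).loc ≠ (run N U ℓ v 0 f τ).loc ∨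
      (run N U ℓ v 0 f (τ + 1)).moves ≠ (run N U ℓ v 0 f τ).moves) :
    ∃ i, ℓ < 2 ^ i ∧ activeStart ℓ i ≤ τ ∧ τ < activeStart ℓ i + 3 * 2 ^ i := by
  have hI := clockInvariant_run N U ℓ v f τ
  have hbusy : (run N U ℓ v 0 f τ).mem.Busy ℓ := by
    by_contra hb
    rw [run_zero_succ, round_of_decision_none (decision_eq_none_of_not_busy hb)] at h
    simp at h
  obtain ⟨hs, ht⟩ := hbusy
  have hlt := hI.stage_lt
  have htime := hI.time_eq
  have hmul := hI.mul_eq hs.le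
  rw [hs] at hlt htime
  rw [max_eq_left (lt_two_pow_iff_firstPhase_le.1 hlt)] at hmul
  rw [hmul] at ht
  exact ⟨_, hlt, by rw [activeStart]; omega, by rw [activeStart]; omega⟩

theorem moves_mono : Monotone fun τ => (run N U ℓ v 0 f τ).moves := by
  refine monotone_nat_of_le_succ fun τ => ?_
  rw [run_zero_succ]
  unfold AgentState.round
  split <;> simp

/-- The cost of the first phases is at most the total number of steps in their explorations. -/
theorem moves_phaseStart_le {cb : ℕ} (hF : DelayBound N U ℓ v f cb)
    (hU : ∀ u, (U u).length = u) (i : ℕ) :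
    (run N U ℓ v 0 f (phaseStart i)).moves
      ≤ ∑ l ∈ Finset.Ico (firstPhase ℓ) i, 3 * phaseU N U ℓ v f l := by
  -- without active rounds the number of moves is constant
  have hconst : ∀ a b, a ≤ b → (∀ τ, a ≤ τ → τ < b → ∀ i, ℓ < 2 ^ i → activeStart ℓ i ≤ τ →
      activeStart ℓ i + 3 * 2 ^ i ≤ τ) →
      (run N U ℓ v 0 f b).moves = (run N U ℓ v 0 f a).moves := by
    intro a b hab
    induction b, hab using Nat.le_induction with
    | base => exact fun _ => rfl
    | succ b hab ih =>
      intro h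
      rw [← ih fun τ h1 h2 => h τ h1 (by omega)]
      by_contra hne
      obtain ⟨i, h1, h2, h3⟩ := exists_phase_of_run_ne N U v f (Or.inr hne)
      have := h b hab (by omega) i h1 h2
      omega
  have hphase : ∀ {i j τ}, ℓ < 2 ^ j → phaseStart i ≤ τ → τ < phaseStart (i + 1) →
      activeStart ℓ j ≤ τ → τ < activeStart ℓ j + 3 * 2 ^ j → j = i := by
    intro i j τ hj h1 h2 h3 h4
    have h5 := activeStart_add_le hj
    have h6 : 3 * 2 ^ j ≤ 2 ^ (j + 4) := by rw [pow_add]; omega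
    have h7 : phaseStart j ≤ activeStart ℓ j := Nat.le_add_right _ _
    by_contra hne
    rcases lt_or_gt_of_ne hne with h | h
    · have := phaseStart_succ_le h
      omega
    · have := phaseStart_succ_le h
      omega
  induction i with
  | zero => simp [phaseStart_zero, run, AgentState.initial]
  | succ i ih =>
    have hle : phaseStart i ≤ phaseStart (i + 1) := phaseStart_mono (Nat.le_succ i)
    by_cases hi : ℓ < 2 ^ i
    · obtain ⟨σ, -, h1, -⟩ := run_explorations N U v f hF hU hi le_rfl
      have h6 : 3 * 2 ^ i ≤ 2 ^ (i + 4) := by rw [pow_add]; omega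
      have h7 := activeStart_add_le hi
      have h8 : phaseStart i ≤ activeStart ℓ i := Nat.le_add_right _ _
      rw [Finset.sum_Ico_succ_top (lt_two_pow_iff_firstPhase_le.1 hi)]
      have h9 := hconst (phaseStart i) (activeStart ℓ i) h8 fun τ h1 h2 j hj h3 => by
        by_contra h4
        obtain rfl := hphase hj h1 (by omega) h3 (by omega)
        omega
      have h10 := hconst (activeStart ℓ i + 3 * 2 ^ i) (phaseStart (i + 1)) (by omega)
        fun τ h1 h2 j hj h3 => by
          by_contra h4
          obtain rfl := hphase hj (by omega) h2 h3 (by omega)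
          omega
      omega
    · have h9 := hconst _ _ hle fun τ h1 h2 j hj h3 => by
        by_contra h4
        obtain rfl := hphase hj h1 h2 h3 (by omega)
        exact hi hj
      have : firstPhase ℓ ≥ i + 1 := by
        have : ¬ firstPhase ℓ ≤ i := by rwa [← lt_two_pow_iff_firstPhase_le]
        omega
      rw [Finset.Ico_eq_empty_of_le this]
      rw [Finset.Ico_eq_empty_of_le (by omega)] at ih
      omega

/-- Three moves in the same phase happen in different steps, hence take more than the length of a
step. -/
theorem phaseC_le_of_three_moves {cb i : ℕ} (hF : DelayBound N U ℓ v f cb) (hi : ℓ < 2 ^ i)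
    {t₁ t₂ t₃ : ℕ} (h₁ : activeStart ℓ i ≤ t₁) (h₁₂ : t₁ < t₂) (h₂₃ : t₂ < t₃)
    (h₃ : t₃ < activeStart ℓ i + 3 * 2 ^ i)
    (hm₁ : (run N U ℓ v 0 f (t₁ + 1)).loc ≠ (run N U ℓ v 0 f t₁).loc)
    (hm₂ : (run N U ℓ v 0 f (t₂ + 1)).loc ≠ (run N U ℓ v 0 f t₂).loc)
    (hm₃ : (run N U ℓ v 0 f (t₃ + 1)).loc ≠ (run N U ℓ v 0 f t₃).loc) :
    phaseC N U ℓ v f i ≤ t₃ - t₁ := by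
  have hcu := phaseC_mul_phaseU N U v f hi
  have hc := phaseC_pos N U v f hi
  have hstart := run_mem_activeStart N U v f hi
  set c := phaseC N U ℓ v f i
  set u := phaseU N U ℓ v f i
  set s := activeStart ℓ i
  have hbound : ∀ k, k < 3 * u → c * k + c ≤ 3 * (c * u) := fun k hk => by
    rw [← Nat.mul_succ, mul_left_comm]; exact Nat.mul_le_mul_left _ hk
  have hsteps : ∀ k ≤ 3 * u, ∃ σ β, (run N U ℓ v 0 f (s + c * k)).mem
      = ⟨i, ℓ, c * k, u, c, σ, β, false⟩ := by
    intro k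
    induction k with
    | zero => exact fun _ => ⟨true, false, by simpa using hstart⟩
    | succ k ih =>
      intro hk
      obtain ⟨σ, β, h⟩ := ih (by omega)
      obtain ⟨_, _, _, _, _, hend⟩ := run_step N U ℓ v f hF hc (Dvd.intro _ rfl)
        (hbound k (by omega)) h
      exact ⟨_, _, by rw [Nat.mul_succ, ← add_assoc, hend]⟩
  -- there is at most one move in each step
  have huniq : ∀ k < 3 * u, ∃ k₀, ∀ r < c, (run N U ℓ v 0 f (s + c * k + r + 1)).loc
      ≠ (run N U ℓ v 0 f (s + c * k + r)).loc → r = k₀ := by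
    intro k hk
    obtain ⟨σ, β, h⟩ := hsteps k hk.le
    obtain ⟨k₀, _, _, _, hr, hend⟩ := run_step N U ℓ v f hF hc (Dvd.intro _ rfl) (hbound k hk) h
    refine ⟨k₀, fun r hrc hne => ?_⟩
    have hloc : ∀ r ≤ c, (run N U ℓ v 0 f (s + c * k + r)).loc = if k₀ < r then
        stepTarget N U u (run N U ℓ v 0 f (s + c * k)).loc (c * k % (c * u) / c)
          else (run N U ℓ v 0 f (s + c * k)).loc := by
      intro r hr'
      rcases hr'.eq_or_lt with rfl | hlt
      · rw [hend]
      · rw [hr r hlt]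
    rw [add_assoc (s + c * k), hloc _ hrc, hloc _ hrc.le] at hne
    by_contra hrk
    refine hne ?_
    have : k₀ < r + 1 ↔ k₀ < r := by omega
    simp [this]
  have hdiff : ∀ t t', s ≤ t → t < t' → t' < s + 3 * 2 ^ i →
      (run N U ℓ v 0 f (t + 1)).loc ≠ (run N U ℓ v 0 f t).loc →
      (run N U ℓ v 0 f (t' + 1)).loc ≠ (run N U ℓ v 0 f t').loc →
      (t - s) / c < (t' - s) / c := by
    intro t t' h1 h2 h3 hm hm'
    refine lt_of_le_of_ne (Nat.div_le_div_right (by omega)) fun heq => ?_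
    have hk : (t - s) / c < 3 * u := by
      rw [Nat.div_lt_iff_lt_mul hc, mul_assoc, mul_comm u c, hcu]; omega
    obtain ⟨k₀, hk₀⟩ := huniq _ hk
    have e1 : t = s + c * ((t - s) / c) + (t - s) % c := by
      have := Nat.div_add_mod (t - s) c; omega
    have e2 : t' = s + c * ((t - s) / c) + (t' - s) % c := by
      have := Nat.div_add_mod (t' - s) c; rw [← heq] at this; omega
    have h4 := hk₀ _ (Nat.mod_lt (t - s) hc) (by rwa [← e1])
    have h5 := hk₀ _ (Nat.mod_lt (t' - s) hc) (by rwa [← e2])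
    omega
  have h1 := hdiff t₁ t₂ h₁ h₁₂ (by omega) hm₁ hm₂
  have h2 := hdiff t₂ t₃ (by omega) h₂₃ h₃ hm₂ hm₃
  have h3 : c * ((t₁ - s) / c + 2) ≤ c * ((t₃ - s) / c) := Nat.mul_le_mul_left _ (by omega)
  have h4 := Nat.div_add_mod (t₁ - s) c
  have h5 := Nat.mod_lt (t₁ - s) hc
  have h6 := Nat.mul_div_le (t₃ - s) c
  rw [mul_add] at h3
  omega

end GraphRVBF

/-! ### Overlaps of active periods -/

namespace GraphRVBF

/-- Round `t` belongs to the explorations of phase `i` of the agent with label `ℓ` that is woken up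
in round `w`. -/
structure InActive (w ℓ i t : ℕ) : Prop where
  lt : ℓ < 2 ^ i
  le_time : w + activeStart ℓ i ≤ t
  time_lt : t < w + activeStart ℓ i + 3 * 2 ^ i

theorem three_mul_phaseStart (i : ℕ) : 3 * phaseStart i + 16 = 16 * (2 ^ i * 2 ^ i) := by
  induction i with
  | zero => rfl
  | succ i ih => rw [phaseStart_succ, mul_add]; ring_nf at ih ⊢; omega

theorem three_mul_activeStart (ℓ i : ℕ) :
    (3 * activeStart ℓ i : ℤ) = 16 * (2 ^ i * 2 ^ i) - 16 + 48 * (ℓ * 2 ^ i) := by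
  have h : (3 * phaseStart i + 16 : ℤ) = 16 * (2 ^ i * 2 ^ i) := by
    exact_mod_cast three_mul_phaseStart i
  rw [activeStart]; push_cast; rw [pow_add]; linarith

theorem activeStart_add_le_of_lt {ℓ i i' : ℕ} (hi : ℓ < 2 ^ i) (h : i < i') :
    activeStart ℓ i + 16 * 2 ^ i ≤ activeStart ℓ i' := by
  have h1 := activeStart_add_le hi
  have h2 := phaseStart_succ_le h
  rw [pow_add] at h1
  unfold activeStart at h1 ⊢
  omega

theorem two_mul_two_pow_le {i i' : ℕ} (h : i < i') : (2 * 2 ^ i : ℤ) ≤ 2 ^ i' := by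
  rw [← pow_succ']; exact pow_le_pow_right₀ (by norm_num) h

theorem InActive.cast {w ℓ i t : ℕ} (h : InActive w ℓ i t) :
    (ℓ + 1 ≤ (2 : ℤ) ^ i) ∧ 3 * w + 16 * ((2 : ℤ) ^ i * 2 ^ i) - 16 + 48 * (ℓ * 2 ^ i) ≤ (3 * t : ℤ) ∧
      (3 * t : ℤ) < 3 * w + 16 * (2 ^ i * 2 ^ i) - 16 + 48 * (ℓ * 2 ^ i) + 9 * 2 ^ i := by
  have h0 := three_mul_activeStart ℓ i
  have h1 : (ℓ + 1 : ℤ) ≤ 2 ^ i := by exact_mod_cast h.lt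
  have h2 : (w + activeStart ℓ i : ℤ) ≤ t := by exact_mod_cast h.le_time
  have h3 : (t : ℤ) < w + activeStart ℓ i + 3 * 2 ^ i := by exact_mod_cast h.time_lt
  exact ⟨h1, by linarith, by linarith⟩

theorem InActive.wake_le {w ℓ i t : ℕ} (h : InActive w ℓ i t) : w ≤ t :=
  (Nat.le_add_right _ _).trans h.le_time

theorem InActive.phase_le {w ℓ i j t t' : ℕ} (h : InActive w ℓ i t) (h' : InActive w ℓ j t')
    (htt' : t ≤ t') : i ≤ j := by
  by_contra hlt
  have h1 := activeStart_add_le_of_lt h'.lt (not_le.1 hlt)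
  have h2 := h.le_time
  have h3 := h'.time_lt
  omega

/-- The time between rounds in the explorations of two different phases is at least quadratic in
the length of an exploration of the later phase. -/
theorem InActive.quadratic_gap {w ℓ i j t t' : ℕ} (hℓ : 1 ≤ ℓ) (h : InActive w ℓ i t)
    (h' : InActive w ℓ j t') (hij : i < j) :
    12 * ((2 : ℤ) ^ j * 2 ^ j) ≤ 3 * (t' - t) := by
  obtain ⟨-, -, h1⟩ := h.cast
  obtain ⟨-, h2, -⟩ := h'.cast
  have h3 := two_mul_two_pow_le hij
  have h4 : (1 : ℤ) ≤ ℓ := by exact_mod_cast hℓ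
  have h5 : (0 : ℤ) < 2 ^ i := by positivity
  generalize (2 : ℤ) ^ i = x at *
  generalize (2 : ℤ) ^ j = y at *
  have h6 : 4 * (x * x) ≤ y * y := by nlinarith
  have h7 : (y - x) ≤ ℓ * (y - x) := le_mul_of_one_le_left (by linarith) h4
  linarith

/-- The time between the wake-up and a round of phase `i` is at most quadratic in `2 ^ i`. -/
theorem InActive.elapsed_lt {w ℓ i t : ℕ} (h : InActive w ℓ i t) :
    (3 * t : ℤ) < 3 * w + 64 * (2 ^ i * 2 ^ i) := by
  obtain ⟨h1, -, h3⟩ := h.cast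
  have h5 : (0 : ℤ) < 2 ^ i := by positivity
  generalize (2 : ℤ) ^ i = x at *
  have : (ℓ : ℤ) * x ≤ (x - 1) * x := by gcongr; linarith
  linarith

/-- The explorations of phase `i` of one agent overlap in time with those of phase `j` of the
other agent. -/
def Overlap (w ℓ w' ℓ' i j : ℕ) : Prop := ∃ t, InActive w ℓ i t ∧ InActive w' ℓ' j t

theorem Overlap.symm {w ℓ w' ℓ' i j : ℕ} (h : Overlap w ℓ w' ℓ' i j) : Overlap w' ℓ' w ℓ j i :=
  let ⟨t, h1, h2⟩ := h
  ⟨t, h2, h1⟩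

section

variable {w ℓ w' ℓ' : ℕ}

/-- The agent woken up earlier is in the later phase. -/
theorem Overlap.phase_le (hw : w ≤ w') {i j : ℕ} (h : Overlap w ℓ w' ℓ' i j) : j ≤ i := by
  obtain ⟨t, h1, h2⟩ := h
  have h3 := h1.elapsed_lt
  obtain ⟨-, h4, -⟩ := h2.cast
  by_contra hlt
  have h5 := two_mul_two_pow_le (not_le.1 hlt)
  obtain ⟨h6, -, h8⟩ := h1.cast
  have h7 : (0 : ℤ) < 2 ^ i := by positivity
  have h9 : (0 : ℤ) < 2 ^ j := by positivity
  have hw' : (w : ℤ) ≤ w' := by exact_mod_cast hw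
  generalize (2 : ℤ) ^ i = x at *
  generalize (2 : ℤ) ^ j = y at *
  have h10 : 4 * (x * x) ≤ y * y := by nlinarith
  have h11 : (ℓ : ℤ) * x ≤ (x - 1) * x := by gcongr; linarith
  have h12 : (0 : ℤ) ≤ ℓ' * y := by positivity
  linarith

/-- From the second overlap on, the phases of the two agents differ by at most one. -/
theorem Overlap.le_succ (hℓ : 1 ≤ ℓ) {i j i' j' : ℕ} (h : Overlap w ℓ w' ℓ' i j)
    (h' : Overlap w ℓ w' ℓ' i' j') (hi : i < i') : i' ≤ j' + 1 := by
  obtain ⟨t, h1, h2⟩ := h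
  obtain ⟨t', h1', h2'⟩ := h'
  have h3 := h1.quadratic_gap hℓ h1' hi
  have h4 := h2'.elapsed_lt
  have h5 : (w' : ℤ) ≤ t := by exact_mod_cast h2.wake_le
  by_contra hlt
  have h6 : (4 * 2 ^ j' : ℤ) ≤ 2 ^ i' := by
    have := two_mul_two_pow_le (not_le.1 hlt)
    rw [pow_succ] at this; linarith
  have h7 : (0 : ℤ) < 2 ^ j' := by positivity
  generalize (2 : ℤ) ^ i' = x at *
  generalize (2 : ℤ) ^ j' = y at *
  have h10 : 16 * (y * y) ≤ x * x := by nlinarith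
  have : 0 < y * y := by positivity
  linarith

/-- Agents with different labels are active simultaneously in the same phase for at most one
phase, since in the next phases their active stages move apart. -/
theorem Overlap.not_same (hne : ℓ ≠ ℓ') {i i' : ℕ} (h : Overlap w ℓ w' ℓ' i i)
    (h' : Overlap w ℓ w' ℓ' i' i') : ¬ i < i' := by
  intro hi
  obtain ⟨t, h1, h2⟩ := h
  obtain ⟨t', h1', h2'⟩ := h'
  obtain ⟨-, a1, a2⟩ := h1.cast
  obtain ⟨-, b1, b2⟩ := h2.cast
  obtain ⟨-, a1', a2'⟩ := h1'.cast
  obtain ⟨-, b1', b2'⟩ := h2'.cast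
  have h3 := two_mul_two_pow_le hi
  have h4 : (0 : ℤ) < 2 ^ i := by positivity
  generalize (2 : ℤ) ^ i = x at *
  generalize (2 : ℤ) ^ i' = y at *
  rcases lt_or_gt_of_ne hne with hlt | hlt
  · have h5 : (1 : ℤ) ≤ ℓ' - ℓ := by have : (ℓ : ℤ) < ℓ' := by exact_mod_cast hlt
                                     linarith
    have h6 : (y - x) ≤ (ℓ' - ℓ) * (y - x) := le_mul_of_one_le_left (by linarith) h5
    linarith
  · have h5 : (1 : ℤ) ≤ ℓ - ℓ' := by have : (ℓ' : ℤ) < ℓ := by exact_mod_cast hlt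
                                     linarith
    have h6 : (y - x) ≤ (ℓ - ℓ') * (y - x) := le_mul_of_one_le_left (by linarith) h5
    linarith

/-- The earlier agent is one phase ahead of the other one in at most one overlap, since its lead
grows quadratically while the wake-up times are fixed. -/
theorem Overlap.not_succ (hw : w ≤ w') {j j' : ℕ} (h : Overlap w ℓ w' ℓ' (j + 1) j)
    (h' : Overlap w ℓ w' ℓ' (j' + 1) j') : ¬ j < j' := by
  intro hj
  obtain ⟨t, h1, h2⟩ := h
  obtain ⟨t', h1', h2'⟩ := h'
  obtain ⟨-, a1, a2⟩ := h1.cast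
  obtain ⟨-, b1, b2⟩ := h2.cast
  obtain ⟨-, a1', a2'⟩ := h1'.cast
  obtain ⟨-, b1', b2'⟩ := h2'.cast
  obtain ⟨d, rfl⟩ := Nat.exists_eq_add_of_lt hj
  have hm : (2 : ℤ) ≤ 2 ^ (d + 1) := by
    rw [pow_succ]; have : (1 : ℤ) ≤ 2 ^ d := one_le_pow₀ (by norm_num)
    linarith
  have hpow : (2 : ℤ) ^ (j + d + 1) = 2 ^ (d + 1) * 2 ^ j := by rw [← pow_add]; congr 1; omega
  have h4 : (1 : ℤ) ≤ 2 ^ j := one_le_pow₀ (by norm_num)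
  have hw' : (0 : ℤ) ≤ w' - w := by have : (w : ℤ) ≤ w' := by exact_mod_cast hw
                                    linarith
  rw [pow_succ (2 : ℤ) (j + d + 1), hpow] at a1' a2'
  rw [hpow] at b1' b2'
  rw [pow_succ (2 : ℤ) j] at a1 a2
  generalize (2 : ℤ) ^ (d + 1) = m at *
  generalize (2 : ℤ) ^ j = y at *
  -- the two windows, compared after scaling the first one by the ratio `m` of the phases
  have e1 : 3 * ((w' : ℤ) - w) - 48 * (y * y) - 48 * (2 * (ℓ * y) - ℓ' * y) < 18 * y := by linarith
  have e2 : -3 * ((w' : ℤ) - w) + 48 * (m * y * (m * y)) + 48 * (2 * (ℓ * (m * y)) - ℓ' * (m * y))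
      < 9 * (m * y) := by linarith
  have e3 := mul_lt_mul_of_pos_left e1 (show (0 : ℤ) < m by linarith)
  have e4 : 0 ≤ (m - 1) * ((w' : ℤ) - w) := mul_nonneg (by linarith) hw'
  have e5 : 48 * (m * y * (m * y)) - 48 * (m * (y * y)) < 27 * (m * y) := by linarith
  have e6 : 0 < m * y := by nlinarith
  have e7 : m * y ≤ (m * y) * (m * y - y) := le_mul_of_one_le_right e6.le (by nlinarith)
  linarith

/-- Four overlaps in four different phases of both agents are impossible. -/
theorem not_four_overlaps (hℓ : 1 ≤ ℓ) (hℓ' : 1 ≤ ℓ') (hne : ℓ ≠ ℓ') {i j : ℕ → ℕ}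
    (hi : StrictMono i) (hj : StrictMono j) (h : ∀ k < 4, Overlap w ℓ w' ℓ' (i k) (j k)) :
    False := by
  wlog hw : w ≤ w' generalizing w ℓ w' ℓ' i j
  · exact this hℓ' hℓ hne.symm hj hi (fun k hk => (h k hk).symm) (by omega)
  have h1 : ∀ k, 1 ≤ k → k < 4 → i k = j k ∨ i k = j k + 1 := fun k hk hk4 => by
    have h2 := (h k hk4).phase_le hw
    have h3 := (h 0 (by norm_num)).le_succ hℓ (h k hk4) (hi (by omega))
    omega
  have h2 : ∀ a b, 1 ≤ a → a < b → b < 4 → i a = j a → i b = j b → False := by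
    intro a b ha hab hb h3 h4
    have h5 := h a (by omega)
    have h6 := h b hb
    have h7 := hj hab
    rw [h3] at h5
    rw [h4] at h6
    exact h5.not_same hne h6 h7
  have h3 : ∀ a b, 1 ≤ a → a < b → b < 4 → i a = j a + 1 → i b = j b + 1 → False := by
    intro a b ha hab hb h3 h4
    have h5 := h a (by omega)
    have h6 := h b hb
    have h7 := hj hab
    rw [h3] at h5
    rw [h4] at h6
    exact h5.not_succ hw h6 h7
  rcases h1 1 le_rfl (by norm_num) with a | a <;>
    rcases h1 2 (by norm_num) (by norm_num) with b | b <;>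
    rcases h1 3 (by norm_num) (by norm_num) with d | d <;>
    first
    | exact h2 1 2 le_rfl (by norm_num) (by norm_num) a b
    | exact h2 1 3 le_rfl (by norm_num) (by norm_num) a d
    | exact h2 2 3 (by norm_num) (by norm_num) (by norm_num) b d
    | exact h3 1 2 le_rfl (by norm_num) (by norm_num) a b
    | exact h3 1 3 le_rfl (by norm_num) (by norm_num) a d
    | exact h3 2 3 (by norm_num) (by norm_num) (by norm_num) b d

end

/-! ### Rendezvous -/

/-- What the proof of rendezvous uses about one agent: `pos t` is its node in round `t`, it is
woken up in round `w`, `u i` and `c i` are its estimates in phase `i`, `succ i` tells whether the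
explorations of phase `i` succeed, explorations with parameter at least `P` are exhaustive, and
`cb` bounds the delays. Phases without an active stage are irrelevant. -/
structure Schedule {V : Type*} (pos : ℕ → V) (w ℓ P cb : ℕ) (u c : ℕ → ℕ) (succ : ℕ → Prop) :
    Prop where
  label_pos : 1 ≤ ℓ
  u_first : u (firstPhase ℓ) = 1
  c_first : c (firstPhase ℓ) = 2 ^ firstPhase ℓ
  mul_eq : ∀ i, ℓ < 2 ^ i → c i * u i = 2 ^ i
  of_succ : ∀ i, ℓ < 2 ^ i → succ i → u (i + 1) = 2 * u i ∧ c (i + 1) = c i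
  of_not_succ : ∀ i, ℓ < 2 ^ i → ¬ succ i → u (i + 1) = u i ∧ c (i + 1) = 2 * c i
  c_le : ∀ i, ℓ < 2 ^ i → ¬ succ i → c i ≤ cb
  active_of_move : ∀ t, pos (t + 1) ≠ pos t → ∃ i, InActive w ℓ i t
  c_le_sub : ∀ i t₁ t₂ t₃, InActive w ℓ i t₁ → InActive w ℓ i t₃ → t₁ < t₂ → t₂ < t₃ →
    pos (t₁ + 1) ≠ pos t₁ → pos (t₂ + 1) ≠ pos t₂ → pos (t₃ + 1) ≠ pos t₃ → c i ≤ t₃ - t₁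
  visits : ∀ i, ℓ < 2 ^ i → succ i → P ≤ u i → ∀ e < 3, ∀ z, ∃ t,
    w + activeStart ℓ i + e * 2 ^ i ≤ t ∧ t ≤ w + activeStart ℓ i + (e + 1) * 2 ^ i ∧ pos t = z

namespace Schedule

variable {V : Type*} {pos pos' : ℕ → V} {w ℓ P cb w' ℓ' : ℕ} {u c u' c' : ℕ → ℕ}
  {succ succ' : ℕ → Prop}

theorem exists_succ_of_le (h : Schedule pos w ℓ P cb u c succ) {M i : ℕ} (hM : 1 ≤ M)
    (hi : ℓ < 2 ^ i) (hu : 2 * M ≤ u i) : ∃ i' < i, ℓ < 2 ^ i' ∧ succ i' ∧ M ≤ u i' := by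
  have hi' := lt_two_pow_iff_firstPhase_le.1 hi
  induction i, hi' using Nat.le_induction with
  | base => rw [h.u_first] at hu; omega
  | succ i hle ih =>
    have hi := lt_two_pow_iff_firstPhase_le.2 hle
    by_cases hs : succ i
    · have := (h.of_succ i hi hs).1
      exact ⟨i, by omega, hi, hs, by omega⟩
    · have := (h.of_not_succ i hi hs).1
      obtain ⟨i', h1, h2⟩ := ih hi (by omega)
      exact ⟨i', by omega, h2⟩

theorem c_le_max (h : Schedule pos w ℓ P cb u c succ) {i : ℕ} (hi : ℓ < 2 ^ i) :
    c i ≤ max (2 ^ firstPhase ℓ) (2 * cb) := by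
  have hi' := lt_two_pow_iff_firstPhase_le.1 hi
  induction i, hi' using Nat.le_induction with
  | base => rw [h.c_first]; exact le_max_left _ _
  | succ i hle ih =>
    have hi := lt_two_pow_iff_firstPhase_le.2 hle
    by_cases hs : succ i
    · rw [(h.of_succ i hi hs).2]; exact ih hi
    · rw [(h.of_not_succ i hi hs).2]
      exact le_max_of_le_right (Nat.mul_le_mul_left _ (h.c_le i hi hs))

theorem u_le_two_pow (h : Schedule pos w ℓ P cb u c succ) {i : ℕ} (hi : ℓ < 2 ^ i) :
    u i ≤ 2 ^ i := by
  have := h.mul_eq i hi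
  have hc : 0 < c i := Nat.pos_of_ne_zero fun h0 => by
    rw [h0, zero_mul] at this; exact absurd this (by positivity)
  rw [← this]; exact Nat.le_mul_of_pos_left _ hc

/-- An agent that makes exhaustive explorations without meeting the other agent is disturbed in
each of them by a move of the other agent. -/
theorem exists_move (h : Schedule pos w ℓ P cb u c succ) {T i : ℕ}
    (hT : ∀ t < T, pos t ≠ pos' t) (hi : ℓ < 2 ^ i) (hs : succ i) (hP : P ≤ u i)
    (hiT : w + phaseStart (i + 1) ≤ T) {e : ℕ} (he : e < 3) :
    ∃ t, w + activeStart ℓ i + e * 2 ^ i ≤ t ∧ t < w + activeStart ℓ i + (e + 1) * 2 ^ i ∧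
      InActive w ℓ i t ∧ pos' (t + 1) ≠ pos' t := by
  by_contra hcon
  push Not at hcon
  have hp : 0 < 2 ^ i := by positivity
  have he2 : (e + 1) * 2 ^ i ≤ 3 * 2 ^ i := Nat.mul_le_mul_right _ he
  set s := w + activeStart ℓ i + e * 2 ^ i with hs_def
  have hs1 : w + activeStart ℓ i + (e + 1) * 2 ^ i = s + 2 ^ i := by rw [hs_def]; ring
  rw [hs1] at hcon
  have hconst : ∀ t, s ≤ t → t ≤ s + 2 ^ i → pos' t = pos' s := by
    intro t hst
    induction t, hst using Nat.le_induction with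
    | base => exact fun _ => rfl
    | succ t hst ih =>
      intro ht
      rw [← ih (by omega)]
      exact hcon t hst (by omega) ⟨hi, by omega, by omega⟩
  obtain ⟨t, h1, h2, h3⟩ := h.visits i hi hs hP e he (pos' s)
  rw [hs1] at h2
  have h4 := activeStart_add_le hi
  rw [pow_add] at h4
  exact hT t (by omega) (h3.trans (hconst t h1 h2).symm)

/-- Two phases of an agent with large exhaustive explorations are not disturbed in the same phase
of the other agent. -/
theorem not_same_phase (h : Schedule pos w ℓ P cb u c succ)
    (h' : Schedule pos' w' ℓ' P cb u' c' succ') (hP : 1 ≤ P) {T i i' j t t' : ℕ}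
    (hT : ∀ t < T, pos t ≠ pos' t) (hii' : i < i') (hs : succ i') (hu : 8 * P ≤ u i')
    (hiT : w + phaseStart (i' + 1) ≤ T) (ht : InActive w ℓ i t) (ht' : InActive w ℓ i' t')
    (htfirst : t' < w + activeStart ℓ i' + 2 ^ i')
    (hjt : InActive w' ℓ' j t) (hjt' : InActive w' ℓ' j t') (hmove : pos' (t' + 1) ≠ pos' t') :
    False := by
  have hgap := ht.quadratic_gap h.label_pos ht' hii'
  -- phase `j` lasts long compared with phase `i'`
  have hlen : 4 * (2 ^ i' * 2 ^ i') < 3 * 2 ^ j := by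
    have h1 := hjt.cast.2.1
    have h2 := hjt'.cast.2.2
    have : (4 * (2 ^ i' * 2 ^ i') : ℤ) < 3 * 2 ^ j := by linarith
    exact_mod_cast this
  have hx8 : 8 ≤ 2 ^ i' := by have := h.u_le_two_pow ht'.lt; omega
  obtain ⟨t₂, h21, h22, -, h2move⟩ := h.exists_move hT ht'.lt hs (by omega) hiT (e := 1) (by norm_num)
  obtain ⟨t₃, h31, h32, h3act, h3move⟩ := h.exists_move hT ht'.lt hs (by omega) hiT (e := 2)
    (by norm_num)
  -- the moves that disturb the three explorations of phase `i'` belong to phase `j`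
  obtain ⟨j₃, hj₃⟩ := h'.active_of_move t₃ h3move
  obtain rfl : j = j₃ := by
    have hle := hjt'.phase_le hj₃ (by omega)
    refine hle.eq_or_lt.resolve_right fun hlt => ?_
    have h1 := activeStart_add_le_of_lt hjt'.lt hlt
    have h2 := hj₃.le_time
    have h3 := hjt'.time_lt
    have h4 := ht'.le_time
    have h5 : 8 * 2 ^ i' ≤ 2 ^ i' * 2 ^ i' := Nat.mul_le_mul_right _ hx8
    omega
  have hc := h'.c_le_sub j t' t₂ t₃ hjt' hj₃ (by omega) (by omega) hmove h2move h3move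
  have hmul := h'.mul_eq j hjt.lt
  have hc3 : c' j ≤ 3 * 2 ^ i' := by have := ht'.le_time; omega
  have huj : 4 * 2 ^ i' < 9 * u' j := by
    have h1 : 4 * (2 ^ i' * 2 ^ i') < 3 * (3 * 2 ^ i' * u' j) := by
      calc _ < 3 * 2 ^ j := hlen
        _ = 3 * (c' j * u' j) := by rw [hmul]
        _ ≤ _ := by gcongr
    by_contra hcon
    have h2 := Nat.mul_le_mul_left (2 ^ i') (not_lt.1 hcon)
    linarith only [h1, h2]
  have huP : 2 * P ≤ u' j := by have := h.u_le_two_pow ht'.lt; omega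
  -- hence the other agent made exhaustive explorations in an earlier phase, and was disturbed
  obtain ⟨j', hj', hj'lt, hs', hP'⟩ := h'.exists_succ_of_le hP hjt.lt huP
  have hj'T : w' + phaseStart (j' + 1) ≤ T := by
    have h1 := phaseStart_succ_le hj'
    have h2 := hjt'.le_time
    have h3 : phaseStart j ≤ activeStart ℓ' j := Nat.le_add_right _ _
    have h4 := ht'.time_lt
    have h5 := activeStart_add_le ht'.lt
    rw [pow_add] at h5
    omega
  obtain ⟨m, -, -, hm, hmmove⟩ := h'.exists_move (pos' := pos) (fun t ht => (hT t ht).symm) hj'lt hs'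
    hP' hj'T (e := 0) (by norm_num)
  obtain ⟨i₀, hi₀⟩ := h.active_of_move m hmmove
  have hgap' := hm.quadratic_gap h'.label_pos hjt' hj'
  have helapsed := ht'.elapsed_lt
  have hwm : (w : ℤ) ≤ m := by exact_mod_cast hi₀.wake_le
  have hlen' : (4 * (2 ^ i' * 2 ^ i') : ℤ) < 3 * 2 ^ j := by exact_mod_cast hlen
  have hx8' : (8 : ℤ) ≤ 2 ^ i' := by exact_mod_cast hx8
  generalize (2 : ℤ) ^ j = y at hgap' hlen'
  generalize (2 : ℤ) ^ i' = x at helapsed hlen' hx8'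
  have h64 : 8 * 8 ≤ x * x := mul_le_mul hx8' hx8' (by norm_num) (by linarith only [hx8'])
  have hy : 12 * (y * y) < 48 * y := by linarith only [hgap', helapsed, hlen', hwm]
  have hy4 : 4 * y ≤ y * y :=
    mul_le_mul_of_nonneg_right (by linarith only [h64, hlen']) (by linarith only [h64, hlen'])
  linarith only [hy, hy4]

/-- The estimate `u` exceeds the length of an exhaustive exploration by at most a constant factor
before rendezvous. -/
theorem u_lt (h : Schedule pos w ℓ P cb u c succ) (h' : Schedule pos' w' ℓ' P cb u' c' succ')
    (hne : ℓ ≠ ℓ') (hP : 1 ≤ P) {T i : ℕ} (hT : ∀ t < T, pos t ≠ pos' t) (hi : ℓ < 2 ^ i)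
    (hiT : w + phaseStart i ≤ T) : u i < 128 * P := by
  by_contra hu
  obtain ⟨i₃, hlt₃, hi₃, hs₃, hu₃⟩ := h.exists_succ_of_le (M := 64 * P) (by omega) hi (by omega)
  obtain ⟨i₂, hlt₂, hi₂, hs₂, hu₂⟩ := h.exists_succ_of_le (M := 32 * P) (by omega) hi₃ (by omega)
  obtain ⟨i₁, hlt₁, hi₁, hs₁, hu₁⟩ := h.exists_succ_of_le (M := 16 * P) (by omega) hi₂ (by omega)
  obtain ⟨i₀, hlt₀, hi₀, hs₀, hu₀⟩ := h.exists_succ_of_le (M := 8 * P) (by omega) hi₁ (by omega)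
  have hphase : ∀ k < i, w + phaseStart (k + 1) ≤ T := fun k hk => by
    have := phaseStart_succ_le hk
    omega
  have hdist : ∀ k, ℓ < 2 ^ k → k < i → succ k → 8 * P ≤ u k → ∃ t j, InActive w ℓ k t ∧
      t < w + activeStart ℓ k + 2 ^ k ∧ InActive w' ℓ' j t ∧ pos' (t + 1) ≠ pos' t := by
    intro k hk hki hs hu
    obtain ⟨t, -, h2, h3, h4⟩ := h.exists_move hT hk hs (by omega) (hphase k hki) (e := 0)
      (by norm_num)
    obtain ⟨j, hj⟩ := h'.active_of_move t h4
    exact ⟨t, j, h3, by simpa using h2, hj, h4⟩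
  have hlt : ∀ {k k' t t' j j'}, k < k' → k' < i → succ k' → 8 * P ≤ u k' →
      InActive w ℓ k t → InActive w ℓ k' t' → t' < w + activeStart ℓ k' + 2 ^ k' →
      InActive w' ℓ' j t → InActive w' ℓ' j' t' → pos' (t' + 1) ≠ pos' t' → j < j' := by
    intro k k' t t' j j' hkk' hk'i hs hu a a' hfirst b b' hmove
    have htt' : t ≤ t' := by
      have h1 := activeStart_add_le_of_lt a.lt hkk'
      have h2 := a.time_lt
      have h3 := a'.le_time
      omega
    refine lt_of_le_of_ne (b.phase_le b' htt') ?_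
    rintro rfl
    exact h.not_same_phase h' hP hT hkk' hs hu (hphase k' hk'i) a a' hfirst b b' hmove
  obtain ⟨t₀, j₀, a₀, f₀, b₀, m₀⟩ := hdist i₀ hi₀ (by omega) hs₀ (by omega)
  obtain ⟨t₁, j₁, a₁, f₁, b₁, m₁⟩ := hdist i₁ hi₁ (by omega) hs₁ (by omega)
  obtain ⟨t₂, j₂, a₂, f₂, b₂, m₂⟩ := hdist i₂ hi₂ (by omega) hs₂ (by omega)
  obtain ⟨t₃, j₃, a₃, f₃, b₃, m₃⟩ := hdist i₃ hi₃ (by omega) hs₃ (by omega)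
  have hj₁ := hlt hlt₀ (by omega) hs₁ (by omega) a₀ a₁ f₁ b₀ b₁ m₁
  have hj₂ := hlt hlt₁ (by omega) hs₂ (by omega) a₁ a₂ f₂ b₁ b₂ m₂
  have hj₃ := hlt hlt₂ (by omega) hs₃ (by omega) a₂ a₃ f₃ b₂ b₃ m₃
  refine not_four_overlaps h.label_pos h'.label_pos hne
    (i := fun k => match k with | 0 => i₀ | 1 => i₁ | 2 => i₂ | k + 3 => i₃ + k)
    (j := fun k => match k with | 0 => j₀ | 1 => j₁ | 2 => j₂ | k + 3 => j₃ + k)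
    (strictMono_nat_of_lt_succ fun k => ?_) (strictMono_nat_of_lt_succ fun k => ?_)
    (w := w) (w' := w') fun k hk => ?_
  · match k with
    | 0 => exact hlt₀
    | 1 => exact hlt₁
    | 2 => exact hlt₂
    | k + 3 => exact Nat.lt_succ_self _
  · match k with
    | 0 => exact hj₁
    | 1 => exact hj₂
    | 2 => exact hj₃
    | k + 3 => exact Nat.lt_succ_self _
  · match k with
    | 0 => exact ⟨t₀, a₀, b₀⟩
    | 1 => exact ⟨t₁, a₁, b₁⟩
    | 2 => exact ⟨t₂, a₂, b₂⟩
    | 3 => exact ⟨t₃, a₃, b₃⟩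

/-- Hence only few phases begin before rendezvous. -/
theorem two_pow_sub_lt (h : Schedule pos w ℓ P cb u c succ)
    (h' : Schedule pos' w' ℓ' P cb u' c' succ') (hne : ℓ ≠ ℓ') (hP : 1 ≤ P) (hcb : 1 ≤ cb)
    {T i : ℕ} (hT : ∀ t < T, pos t ≠ pos' t) (hi : ℓ < 2 ^ i) (hiT : w + phaseStart i ≤ T) :
    2 ^ (i - firstPhase ℓ) < 256 * (P * cb) := by
  have h1 := h.u_lt h' hne hP hT hi hiT
  have h2 := h.c_le_max hi
  have h3 := h.mul_eq i hi
  have h4 : max (2 ^ firstPhase ℓ) (2 * cb) ≤ 2 ^ firstPhase ℓ * (2 * cb) :=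
    max_le (Nat.le_mul_of_pos_right _ (by omega)) (Nat.le_mul_of_pos_left _ (by positivity))
  have h5 : c i * u i < 2 ^ firstPhase ℓ * (2 * cb) * (128 * P) := by
    refine (Nat.mul_le_mul_right _ (h2.trans h4)).trans_lt ?_
    exact Nat.mul_lt_mul_of_pos_left h1 (by positivity)
  have h6 := lt_two_pow_iff_firstPhase_le.1 hi
  rw [h3, ← pow_mul_pow_sub 2 h6] at h5
  refine lt_of_mul_lt_mul_left (h5.trans_le (le_of_eq ?_)) (Nat.zero_le (2 ^ firstPhase ℓ))
  ring

/-- Rendezvous happens: otherwise infinitely many phases would begin before it. -/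
theorem exists_meeting (h : Schedule pos w ℓ P cb u c succ)
    (h' : Schedule pos' w' ℓ' P cb u' c' succ') (hne : ℓ ≠ ℓ') (hP : 1 ≤ P) (hcb : 1 ≤ cb) :
    ∃ t, pos t = pos' t := by
  by_contra hT
  push Not at hT
  have h1 := h.two_pow_sub_lt h' hne hP hcb (fun t _ => hT t)
    (i := firstPhase ℓ + 256 * (P * cb)) (lt_two_pow_iff_firstPhase_le.2 (Nat.le_add_right _ _))
    le_rfl
  rw [Nat.add_sub_cancel_left] at h1
  exact absurd (Nat.lt_two_pow_self (n := 256 * (P * cb))) (by omega)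

end Schedule

end GraphRVBF

/-! ### Exhaustive explorations -/

namespace PortNumbering

variable {V W : Type*} {G : SimpleGraph V}

/-- A port numbering, transported along a bijection of the nodes. -/
def transport (N : PortNumbering G) (e : W ≃ V) : PortNumbering (G.comap e) where
  deg w := N.deg (e w)
  port w := (N.port (e w)).trans
    { toFun := fun x => ⟨e.symm x.1, by
        change G.Adj (e w) (e (e.symm x.1)); rw [e.apply_symm_apply]; exact x.2⟩
      invFun := fun y => ⟨e y.1, y.2⟩
      left_inv := fun x => by simp
      right_inv := fun y => by simp }

theorem cross_transport (N : PortNumbering G) (e : W ≃ V) (s : W × ℕ) {x : ℕ}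
    (hx : x < N.deg (e s.1)) :
    (e ((N.transport e).cross s x).1, ((N.transport e).cross s x).2) = N.cross (e s.1, s.2) x := by
  rw [cross_of_lt _ s hx, cross_of_lt _ (e s.1, s.2) hx]
  have h : ∀ {y z : V} (h : y = z) (a : G.neighborSet y) (b : G.neighborSet z), a.1 = b.1 →
      ((N.port y).symm a : ℕ) = (N.port z).symm b := by
    rintro y _ rfl a b hab
    rw [Subtype.ext hab]
  refine Prod.ext (e.apply_symm_apply _) ?_
  exact h (e.apply_symm_apply _) _ _ rfl

theorem walk_transport (N : PortNumbering G) (e : W ≃ V) (S : List ℕ) (s : W × ℕ)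
    (hs : s.2 < N.deg (e s.1)) {k : ℕ} (hk : k ≤ S.length) :
    (e ((N.transport e).walk S s k).1, ((N.transport e).walk S s k).2)
      = N.walk S (e s.1, s.2) k := by
  induction k with
  | zero => simp [walk_zero]
  | succ k ih =>
    have h1 := ih (by omega)
    have h2 := N.walk_snd_lt S (e s.1, s.2) hs (k := k) (by omega)
    rw [walk_succ _ _ _ hk, walk_succ _ _ _ hk, ← h1]
    rw [← h1] at h2
    exact N.cross_transport e _ (Nat.mod_lt _ ((Nat.zero_le _).trans_lt h2))

/-- A universal exploration sequence explores graphs on arbitrary finite vertex types. -/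
theorem traversesAll_of_isUXS [Fintype V] (N : PortNumbering G) (hG : G.Connected) {S : List ℕ}
    (hS : IsUXS (Fintype.card V) S) (s : V × ℕ) (hs : s.2 < N.deg s.1) : N.TraversesAll S s := by
  set e : Fin (Fintype.card V) ≃ V := (Fintype.equivFin V).symm
  have hconn : (G.comap e).Connected := (SimpleGraph.Iso.comap e G).connected_iff.2 hG
  have hs' : s.2 < (N.transport e).deg (e.symm s.1) := by
    simpa [transport] using hs
  have h := hS _ le_rfl _ hconn (N.transport e) (e.symm s.1) s.2 hs'
  intro d hd
  induction d with | _ a b => ?_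
  obtain ⟨k, hk, hkeq⟩ := h s(e.symm a, e.symm b) (by simpa using hd)
  refine ⟨k, hk, ?_⟩
  have h1 := N.walk_transport e S (e.symm s.1, s.2) hs' hk.le
  have h2 := N.walk_transport e S (e.symm s.1, s.2) hs' (k := k + 1) hk
  simp only [Equiv.apply_symm_apply, Prod.mk.eta] at h1 h2
  rw [← h1, ← h2]
  have h3 := congrArg (Sym2.map e) hkeq
  simpa using h3

end PortNumbering

namespace GraphRVBF

variable {V : Type*} {G : SimpleGraph V}

theorem run_loc_snd_lt (N : PortNumbering G) (U : ℕ → List ℕ) (ℓ : ℕ) {v : V} (hv : 0 < N.deg v)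
    (f : ℕ → Bool) (τ : ℕ) :
    (run N U ℓ v 0 f τ).loc.2 < N.deg (run N U ℓ v 0 f τ).loc.1 := by
  induction τ with
  | zero => exact hv
  | succ τ ih =>
    rw [run_zero_succ]
    unfold AgentState.round
    split
    · next x hx _ =>
      refine N.cross_snd_lt _ ?_
      unfold AgentState.decision action at hx
      split_ifs at hx
      rw [← Option.some.inj hx]
      exact Nat.mod_lt _ (by omega)
    · exact ih

/-- A successful exploration with a sufficiently long exploration sequence visits all nodes. -/
theorem exists_run_loc_eq [Fintype V] [Nontrivial V] {N : PortNumbering G} {U : ℕ → List ℕ} {ℓ : ℕ}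
    {v : V} {f : ℕ → Bool} {P : ℕ → ℕ} (hUP : IsUXSFamily U P) (hG : G.Connected) {cb i : ℕ}
    (hF : DelayBound N U ℓ v f cb) (hi : ℓ < 2 ^ i) (hs : PhaseSuccess N U ℓ v f i)
    (hP : P (Fintype.card V) ≤ phaseU N U ℓ v f i) {e : ℕ} (he : e < 3) (z : V) :
    ∃ τ, activeStart ℓ i + e * 2 ^ i ≤ τ ∧ τ ≤ activeStart ℓ i + (e + 1) * 2 ^ i ∧
      (run N U ℓ v 0 f τ).loc.1 = z := by
  obtain ⟨σ, h1, -, -, h2⟩ := run_explorations N U v f hF hUP.length_eq hi le_rfl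
  rw [PhaseSuccess, h1] at hs
  have hwalk := h2 hs e he
  have hcu := phaseC_mul_phaseU N U v f hi
  obtain ⟨z', hz'⟩ := hG.preconnected.exists_adj_of_nontrivial z
  obtain ⟨v', hv'⟩ := hG.preconnected.exists_adj_of_nontrivial v
  obtain ⟨k, hk, hkz⟩ := N.traversesAll_of_isUXS hG (hUP.isUXS _ _ hP) _
    (run_loc_snd_lt N U ℓ (N.deg_pos_of_adj hv') f (activeStart ℓ i + e * 2 ^ i)) s(z, z') hz'
  rw [hUP.length_eq] at hk
  have hvisit : ∀ k ≤ phaseU N U ℓ v f i, (N.walk (U (phaseU N U ℓ v f i))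
      (run N U ℓ v 0 f (activeStart ℓ i + e * 2 ^ i)).loc k).1 = z →
      ∃ τ, activeStart ℓ i + e * 2 ^ i ≤ τ ∧ τ ≤ activeStart ℓ i + (e + 1) * 2 ^ i ∧
        (run N U ℓ v 0 f τ).loc.1 = z := by
    intro k hk hz
    refine ⟨activeStart ℓ i + e * 2 ^ i + phaseC N U ℓ v f i * k, Nat.le_add_right _ _, ?_, ?_⟩
    · have := Nat.mul_le_mul_left (phaseC N U ℓ v f i) hk
      rw [hcu] at this
      rw [Nat.succ_mul]; omega
    · rw [hwalk k hk, hz]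
  rcases Sym2.eq_iff.1 hkz with h | h
  · exact hvisit k hk.le h.1
  · exact hvisit (k + 1) hk h.2

/-- The algorithm satisfies the requirements on which the proof of rendezvous rests. -/
theorem schedule_run [Fintype V] [Nontrivial V] {N : PortNumbering G} {U : ℕ → List ℕ} {ℓ : ℕ}
    {v : V} {wake : ℕ} {F : ℕ → Bool} {P : ℕ → ℕ} (hUP : IsUXSFamily U P) (hG : G.Connected)
    {cb : ℕ} (hF : FaultBounded N U ℓ v wake F cb) (hℓ : 1 ≤ ℓ) :
    Schedule (fun t => (run N U ℓ v wake F t).loc.1) wake ℓ (P (Fintype.card V)) cb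
      (phaseU N U ℓ v fun r => F (wake + r)) (phaseC N U ℓ v fun r => F (wake + r))
      (PhaseSuccess N U ℓ v fun r => F (wake + r)) := by
  have hD := hF.delayBound
  have hU := hUP.length_eq
  have hmove : ∀ t, (run N U ℓ v wake F (t + 1)).loc.1 ≠ (run N U ℓ v wake F t).loc.1 →
      wake ≤ t ∧ (run N U ℓ v 0 (fun r => F (wake + r)) (t - wake + 1)).loc
        ≠ (run N U ℓ v 0 (fun r => F (wake + r)) (t - wake)).loc := by
    intro t ht
    have hwt : wake ≤ t := by
      by_contra hlt
      rw [run_of_le_wake _ _ _ _ _ (by omega), run_of_le_wake _ _ _ _ _ (by omega)] at ht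
      exact ht rfl
    obtain ⟨τ, rfl⟩ := Nat.exists_eq_add_of_le hwt
    rw [add_assoc, run_wake_add, run_wake_add] at ht
    rw [Nat.add_sub_cancel_left]
    exact ⟨hwt, fun h => ht (congrArg Prod.fst h)⟩
  refine
    { label_pos := hℓ
      u_first := (phaseU_firstPhase N U v _).1
      c_first := (phaseU_firstPhase N U v _).2
      mul_eq := fun i hi => phaseC_mul_phaseU N U v _ hi
      of_succ := fun i hi => (phase_succ_eq N U v _ hD hU hi).1
      of_not_succ := fun i hi => (phase_succ_eq N U v _ hD hU hi).2
      c_le := fun i hi => phaseC_le_of_not_success N U v _ hD hU hi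
      active_of_move := fun t ht => ?_
      c_le_sub := fun i t₁ t₂ t₃ h₁ h₃ h₁₂ h₂₃ m₁ m₂ m₃ => ?_
      visits := fun i hi hs hP e he z => ?_ }
  · obtain ⟨hwt, hne⟩ := hmove t ht
    obtain ⟨i, h1, h2, h3⟩ := exists_phase_of_run_ne N U v _ (Or.inl hne)
    exact ⟨i, h1, by omega, by omega⟩
  · have a₁ := h₁.le_time
    have a₃ := h₃.time_lt
    have := phaseC_le_of_three_moves N U v _ hD h₁.lt (t₁ := t₁ - wake) (t₂ := t₂ - wake)
      (t₃ := t₃ - wake) (by omega) (by omega) (by omega) (by omega) (hmove t₁ m₁).2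
      (hmove t₂ m₂).2 (hmove t₃ m₃).2
    omega
  · obtain ⟨τ, h1, h2, h3⟩ := exists_run_loc_eq hUP hG hD hi hs hP he z
    refine ⟨wake + τ, by omega, by omega, ?_⟩
    rw [run_wake_add, h3]

/-- The cost of one agent until rendezvous. -/
theorem moves_le [Fintype V] [Nontrivial V] {N : PortNumbering G} {U : ℕ → List ℕ} {ℓ ℓ' : ℕ}
    {v v' : V} {wake wake' : ℕ} {F F' : ℕ → Bool} {P : ℕ → ℕ} (hUP : IsUXSFamily U P)
    (hP : 1 ≤ P (Fintype.card V)) (hG : G.Connected) {cb : ℕ} (hcb : 1 ≤ cb)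
    (hF : FaultBounded N U ℓ v wake F cb) (hF' : FaultBounded N U ℓ' v' wake' F' cb)
    (hℓ : 1 ≤ ℓ) (hℓ' : 1 ≤ ℓ') (hne : ℓ ≠ ℓ') {T : ℕ}
    (hT : ∀ t < T, (run N U ℓ v wake F t).loc.1 ≠ (run N U ℓ' v' wake' F' t).loc.1) :
    ((run N U ℓ v wake F T).moves : ℝ) ≤ 384 * P (Fintype.card V) *
      (9 + Real.logb 2 (P (Fintype.card V)) + Real.logb 2 cb) := by
  have h := schedule_run hUP hG hF hℓ
  have h' := schedule_run hUP hG hF' hℓ'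
  set p := P (Fintype.card V)
  have hp : (1 : ℝ) ≤ p := by exact_mod_cast hP
  have hc : (1 : ℝ) ≤ cb := by exact_mod_cast hcb
  have hlogp : 0 ≤ Real.logb 2 p := Real.logb_nonneg (by norm_num) hp
  have hlogc : 0 ≤ Real.logb 2 cb := Real.logb_nonneg (by norm_num) hc
  have hnonneg : 0 ≤ 384 * (p : ℝ) * (9 + Real.logb 2 p + Real.logb 2 cb) := by positivity
  rcases le_total T wake with hTw | hTw
  · rw [run_of_le_wake _ _ _ _ _ hTw]
    simpa [AgentState.initial] using hnonneg
  obtain ⟨τ, rfl⟩ := Nat.exists_eq_add_of_le hTw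
  rw [run_wake_add]
  have hex : ∃ i, τ ≤ phaseStart i := by
    refine ⟨τ, ?_⟩
    have h1 := three_mul_phaseStart τ
    have h2 : τ < 2 ^ τ := Nat.lt_two_pow_self
    have h3 : (τ + 1) * 1 ≤ 2 ^ τ * 2 ^ τ := Nat.mul_le_mul h2 Nat.one_le_two_pow
    omega
  -- the first phase that begins at or after rendezvous
  set i := Nat.find hex with hi_def
  have hi : τ ≤ phaseStart i := Nat.find_spec hex
  have hmoves := (moves_mono N U v _ hi).trans
    (moves_phaseStart_le N U v _ hF.delayBound hUP.length_eq i)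
  have hbefore : ∀ l < i, wake + phaseStart l ≤ wake + τ := fun l hl => by
    have := Nat.find_min hex hl
    omega
  by_cases hqi : i ≤ firstPhase ℓ
  · rw [Finset.Ico_eq_empty_of_le hqi, Finset.sum_empty] at hmoves
    dsimp only at hmoves
    rw [Nat.le_zero.1 hmoves]
    simpa using hnonneg
  · obtain ⟨j, hj⟩ : ∃ j, i = j + 1 := ⟨i - 1, by omega⟩
    have hqj : firstPhase ℓ ≤ j := by omega
    have hsum : ∑ l ∈ Finset.Ico (firstPhase ℓ) i, 3 * phaseU N U ℓ v (fun r => F (wake + r)) l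
        ≤ (i - firstPhase ℓ) * (384 * p) := by
      calc _ ≤ ∑ _l ∈ Finset.Ico (firstPhase ℓ) i, 384 * p := by
            refine Finset.sum_le_sum fun l hl => ?_
            rw [Finset.mem_Ico] at hl
            have := h.u_lt h' hne hP hT (lt_two_pow_iff_firstPhase_le.2 hl.1) (hbefore l hl.2)
            omega
        _ = _ := by simp
    have hpow := h.two_pow_sub_lt h' hne hP hcb hT (lt_two_pow_iff_firstPhase_le.2 hqj)
      (hbefore j (by omega))
    have hlog : ((j - firstPhase ℓ : ℕ) : ℝ) ≤ 8 + Real.logb 2 p + Real.logb 2 cb := by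
      have h1 : ((2 : ℝ) ^ (j - firstPhase ℓ)) ≤ 2 ^ 8 * (p * cb) := by
        have : ((2 ^ (j - firstPhase ℓ) : ℕ) : ℝ) ≤ ((256 * (p * cb) : ℕ) : ℝ) := by
          exact_mod_cast hpow.le
        push_cast at this
        linarith
      have h2 := Real.logb_le_logb_of_le (b := 2) (by norm_num) (by positivity) h1
      rw [Real.logb_mul (by positivity) (by positivity), Real.logb_mul (by positivity)
        (by positivity), Real.logb_pow, Real.logb_pow, Real.logb_self_eq_one (by norm_num)] at h2
      push_cast at h2
      linarith
    have hcount : ((i - firstPhase ℓ : ℕ) : ℝ) ≤ 9 + Real.logb 2 p + Real.logb 2 cb := by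
      have : i - firstPhase ℓ = (j - firstPhase ℓ) + 1 := by omega
      rw [this]; push_cast; linarith
    have hfinal : ((run N U ℓ v 0 (fun r => F (wake + r)) τ).moves : ℝ)
        ≤ ((i - firstPhase ℓ : ℕ) : ℝ) * (384 * p) := by
      exact_mod_cast hmoves.trans hsum
    calc _ ≤ _ := hfinal
      _ ≤ (9 + Real.logb 2 p + Real.logb 2 cb) * (384 * p) := by gcongr
      _ = _ := by ring

theorem one_le_of_isUXSFamily {U : ℕ → List ℕ} {P : ℕ → ℕ} (hUP : IsUXSFamily U P) [Fintype V]
    [Nontrivial V] (hG : G.Connected) (N : PortNumbering G) : 1 ≤ P (Fintype.card V) := by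
  obtain ⟨v⟩ := hG.nonempty
  obtain ⟨v', hv'⟩ := hG.preconnected.exists_adj_of_nontrivial v
  obtain ⟨k, hk, -⟩ := N.traversesAll_of_isUXS hG (hUP.isUXS _ _ le_rfl) (v, 0)
    (N.deg_pos_of_adj hv') s(v, v') hv'
  rw [hUP.length_eq] at hk
  omega

end GraphRVBF
theorem mainTheorem5 :
    -- universal exploration sequences of polynomial length exist
    (∃ (U : ℕ → List ℕ) (p : Polynomial ℕ), IsUXSFamily U (fun n => p.eval n)) ∧
    -- with any such sequences, the algorithm achieves rendezvous at the claimed cost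
    ∃ C : ℝ, ∀ (U : ℕ → List ℕ) (P : ℕ → ℕ), IsUXSFamily U P →
      ∀ (V : Type*) [Fintype V] (G : SimpleGraph V), G.Connected →
      ∀ (N : PortNumbering G) (c : ℕ), 1 ≤ c →
      ∀ ℓ₁ ℓ₂ : ℕ, 1 ≤ ℓ₁ → 1 ≤ ℓ₂ → ℓ₁ ≠ ℓ₂ →
      ∀ v₁ v₂ : V, v₁ ≠ v₂ →
      ∀ (wake₁ wake₂ : ℕ) (F₁ F₂ : ℕ → Bool),
        GraphRVBF.FaultBounded N U ℓ₁ v₁ wake₁ F₁ c →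
        GraphRVBF.FaultBounded N U ℓ₂ v₂ wake₂ F₂ c →
        ∃ T : ℕ,
          IsLeast {t : ℕ | (GraphRVBF.run N U ℓ₁ v₁ wake₁ F₁ t).loc.1 =
            (GraphRVBF.run N U ℓ₂ v₂ wake₂ F₂ t).loc.1} T ∧
          (((GraphRVBF.run N U ℓ₁ v₁ wake₁ F₁ T).moves +
            (GraphRVBF.run N U ℓ₂ v₂ wake₂ F₂ T).moves : ℕ) : ℝ) ≤
            C * (Real.logb 2 (P (Fintype.card V)) + Real.logb 2 c +
              Real.logb 2 (max ℓ₁ ℓ₂ : ℕ)) * (P (Fintype.card V)) := by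
  refine ⟨GraphRVBF.exists_polynomial_isUXSFamily, 7000, ?_⟩
  intro U P hUP V _ G hG N c hc ℓ₁ ℓ₂ hℓ₁ hℓ₂ hne v₁ v₂ hv wake₁ wake₂ F₁ F₂ hF₁ hF₂
  classical
  have : Nontrivial V := ⟨v₁, v₂, hv⟩
  have hP := GraphRVBF.one_le_of_isUXSFamily hUP hG N
  have h₁ := GraphRVBF.schedule_run hUP hG hF₁ hℓ₁
  have h₂ := GraphRVBF.schedule_run hUP hG hF₂ hℓ₂
  have hex := h₁.exists_meeting h₂ hne hP hc
  have hmin : ∀ t < Nat.find hex, (GraphRVBF.run N U ℓ₁ v₁ wake₁ F₁ t).loc.1 ≠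
      (GraphRVBF.run N U ℓ₂ v₂ wake₂ F₂ t).loc.1 := fun t ht => Nat.find_min hex ht
  refine ⟨Nat.find hex, ⟨Nat.find_spec hex, fun t ht => Nat.find_min' hex ht⟩, ?_⟩
  have m₁ := GraphRVBF.moves_le hUP hP hG hc hF₁ hF₂ hℓ₁ hℓ₂ hne hmin
  have m₂ := GraphRVBF.moves_le hUP hP hG hc hF₂ hF₁ hℓ₂ hℓ₁ hne.symm
    fun t ht => (hmin t ht).symm
  -- as the labels differ, the larger one contributes at least `1` to the sum of the logarithms
  have hL : 1 ≤ Real.logb 2 (max ℓ₁ ℓ₂ : ℕ) := by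
    rw [Real.le_logb_iff_rpow_le (by norm_num) (by
      have : 0 < max ℓ₁ ℓ₂ := by omega
      exact_mod_cast this), Real.rpow_one]
    have : 2 ≤ max ℓ₁ ℓ₂ := by omega
    exact_mod_cast this
  have hp : (1 : ℝ) ≤ P (Fintype.card V) := by exact_mod_cast hP
  have hlogp : 0 ≤ Real.logb 2 (P (Fintype.card V)) := Real.logb_nonneg (by norm_num) hp
  have hlogc : 0 ≤ Real.logb 2 c := Real.logb_nonneg (by norm_num) (by exact_mod_cast hc)
  push_cast at m₁ m₂ ⊢
  set p : ℝ := ((P (Fintype.card V) : ℕ) : ℝ)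
  calc _ ≤ 384 * p * (9 + Real.logb 2 p + Real.logb 2 c)
        + 384 * p * (9 + Real.logb 2 p + Real.logb 2 c) := add_le_add m₁ m₂
    _ = p * (768 * (9 + Real.logb 2 p + Real.logb 2 c)) := by ring
    _ ≤ p * (7000 * (Real.logb 2 p + Real.logb 2 c + Real.logb 2 (max ℓ₁ ℓ₂ : ℕ))) := by
        exact mul_le_mul_of_nonneg_left (by linarith) (by linarith)
    _ = _ := by push_cast; ring
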